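/- **Setting.** Let $\kappa$ be a field and $\Gamma$ a discrete subgroup of $\mathbb{R}$. Let $\Lambda=\kappa[\Gamma]$ (finite sums $\sum_{g\in\Gamma}a_gT^g$), and let $\Lambda_\uparrow$ (resp. $\Lambda^\downarrow$) be the Novikov field of formal sums $\sum_{g\in\Gamma}a_gT^g$ with $a_g\in\kappa$ such that for every $C\in\mathbb{R}$ only finitely many $g<C$ (resp. $g>-C$) have $a_g\neq0$. Put $\nu_\uparrow(\sum a_gT^g)=\min\{g: a_g\ne0\}$ and $\nu^\downarrow(\sum a_gT^g)=\max\{g:a_g\neq0\}$ (with $\nu_\uparrow(0)=\infty$, $\nu^\downarrow(0)=-\infty$), and write $\overline{\sum a_gT^g}=\sum a_gT^{-g}$. For a $\Lambda$-module $M$, ${}^\vee M$ is $\mathrm{Hom}_\Lambda(M,\Lambda)$ with $\lambda\in\Lambda$ acting as multiplication by $\bar\lambda$; for a $\Lambda_\uparrow$-vector space $V$, ${}^\vee V$ is $\mathrm{Hom}_{\Lambda_\uparrow}(V,\Lambda_\uparrow)$ regarded as a $\Lambda^\downarrow$-vector space, $\mu\in\Lambda^\downarrow$ acting as multiplication by $\bar\mu$.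 **Poincaré–Novikov structures.** Let $n\in\mathbb{Z}$. A weak $n$-Poincaré–Novikov structure $\mathcal{N}$ consists of, for all $k\in\mathbb{Z}$: - finitely generated $\Lambda$-modules $H_k$ and $\Lambda$-linear maps $\mathcal{D}_k\colon H_k\to{}^\vee H_{n-k}$ that become isomorphisms after tensoring with the fraction field of $\Lambda$ and satisfy $(\mathcal{D}_kx)(y)=\pm\overline{(\mathcal{D}_{n-k}y)(x)}$ for all $x\in H_k$, $y\in H_{n-k}$, with a sign depending only on $k$; - finite-dimensional $\Lambda_\uparrow$-vector spaces $V_k$ with functions $\rho_k\colon V_k\to\mathbb{R}\cup\{-\infty\}$ such that $\rho_k(x)=-\infty$ iff $x=0$, $\rho_k(\lambda x)=\rho_k(x)-\nu_\uparrow(\lambda)$ and $\rho_k(x+y)\le\max\{\rho_k(x),\rho_k(y)\}$; - $\Lambda$-linear maps $S_k\colon H_k\to V_k$ inducing isomorphisms $\Lambda_\uparrow\otimes_\Lambda H_k\cong V_k$. Given $\mathcal{N}$, let $\widetilde S_k\colon H_k\to{}^\vee V_{n-k}$ be the map characterized by $(\widetilde S_kx)(S_{n-k}y)=(\mathcal{D}_kx)(y)$,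 and let ${}^\vee\!\rho_{n-k}(\zeta)=\inf_{0\ne x\in V_{n-k}}\left(\nu_\uparrow(\zeta(x))+\rho_{n-k}(x)\right)$ for $\zeta\in{}^\vee V_{n-k}$. **Essential barcode.** A doubly-orthogonal basis in degree $k$ is a family $e_1,\dots,e_d\in H_k$ that projects to a $\Lambda$-basis of $H_k$ modulo torsion, such that $(S_ke_i)$ is a basis of $V_k$ with $\rho_k(\sum\lambda_iS_ke_i)=\max_i(\rho_k(S_ke_i)-\nu_\uparrow(\lambda_i))$ for all $\lambda_i\in\Lambda_\uparrow$, and $(\widetilde S_ke_i)$ is a basis of ${}^\vee V_{n-k}$ with ${}^\vee\!\rho_{n-k}(\sum\mu_i\widetilde S_ke_i)=\min_i({}^\vee\!\rho_{n-k}(\widetilde S_ke_i)-\nu^\downarrow(\mu_i))$ for all $\mu_i\in\Lambda^\downarrow$. The basis spectrum $\Sigma_k(\mathcal{N})$ is the multiset of the elements $\left([\rho_k(S_ke_i)],\,{}^\vee\!\rho_{n-k}(\widetilde S_ke_i)-\rho_k(S_ke_i)\right)\in(\mathbb{R}/\Gamma)\times\mathbb{R}$ for such a basis. For an interval $I$,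 $I^\Gamma$ denotes its class modulo translation by elements of $\Gamma$. The essential barcode of $\mathcal{N}$ is the family of multisets $\mathcal{B}_k(\mathcal{N})$, $k\in\mathbb{Z}$, where $\mathcal{B}_k(\mathcal{N})$ consists of the $[a,a+\ell]^\Gamma$ for $([a],\ell)\in\Sigma_k(\mathcal{N})$ with $\ell\ge0$ together with the $(a+\ell,a)^\Gamma$ for $([a],\ell)\in\Sigma_{k+1}(\mathcal{N})$ with $\ell<0$. **Morphisms.** Let $t\ge0$, and let $\mathcal{N},\mathcal{N}'$ be weak $n$-Poincaré–Novikov structures with the same $H_k$ and $\mathcal{D}_k$ and with remaining data $(V_k,\rho_k,S_k)$ and $(V_k',\rho_k',S_k')$. A $t$-morphism from $\mathcal{N}$ to $\mathcal{N}'$ consists of $\Lambda_\uparrow$-linear isomorphisms $a_k\colon V_k\to V_k'$ with $S_k'=a_k\circ S_k$ and $|\rho_k'(a_kx)-\rho_k(x)|\le t$ for all $0\ne x\in V_k$. **Statement.** Suppose that there is a $t$-morphism from $\mathcal{N}$ to $\mathcal{N}'$. Then $\mathcal{N}$ and $\mathcal{N}'$ have doubly-orthogonal bases in every degree, so that they have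 essential barcodes, and for any essential barcodes $\mathcal{B}_*(\mathcal{N})$ and $\mathcal{B}_*(\mathcal{N}')$ (computed from any choice of doubly-orthogonal bases) there is a bijection of multisets $\sigma\colon\bigcup_k\mathcal{B}_k(\mathcal{N})\to\bigcup_k\mathcal{B}_k(\mathcal{N}')$ (elements being labelled by their degree $k$) such that: - each $[a,b]^\Gamma\in\mathcal{B}_k(\mathcal{N})$ is sent by $\sigma$ either to some $[a',b']^\Gamma\in\mathcal{B}_k(\mathcal{N}')$ or to some $(b',a')^\Gamma\in\mathcal{B}_{k-1}(\mathcal{N}')$, where in either case $|a'-a|\le t$ and $|b'-b|\le t$; - each $(a,b)^\Gamma\in\mathcal{B}_k(\mathcal{N})$ is sent by $\sigma$ either to some $(a',b')^\Gamma\in\mathcal{B}_k(\mathcal{N}')$ or to some $[b',a']^\Gamma\in\mathcal{B}_{k+1}(\mathcal{N}')$, where in either case $|a'-a|\le t$ and $|b'-b|\le t$. -/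

import Mathlib

noncomputable section

namespace PoincareNovikov

/-! ### The Novikov rings -/

section NovikovSubalgebra

variable (κ : Type*) [Field κ] {G : Type*} [AddCommGroup G] [LinearOrder G]
  [IsOrderedAddMonoid G]

/-- The Hahn series all of whose sublevel supports `{g | a_g ≠ 0 and w g < C}`, `C ∈ ℝ`, are
finite, where `w` is a monotone additive real weight on the exponent group. -/
def novikovSubalgebra (w : G →+ ℝ) (hw : Monotone w) : Subalgebra κ (HahnSeries G κ) where
  carrier := {x | ∀ C : ℝ, {g : G | x.coeff g ≠ 0 ∧ w g < C}.Finite}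
  algebraMap_mem' r C := by
    refine (Set.finite_singleton (0 : G)).subset ?_
    rintro g ⟨hg, -⟩
    by_contra h
    exact hg (by
      rw [HahnSeries.algebraMap_apply]
      simpa using HahnSeries.coeff_single_of_ne h)
  add_mem' := by
    intro x y hx hy C
    refine ((hx C).union (hy C)).subset ?_
    rintro g ⟨hg, hC⟩
    by_cases h : x.coeff g = 0
    · refine Or.inr ⟨fun h' => hg ?_, hC⟩
      simp [h, h']
    · exact Or.inl ⟨h, hC⟩
  mul_mem' := by
    have key : ∀ z : HahnSeries G κ, ∃ m : ℝ, ∀ g, z.coeff g ≠ 0 → m ≤ w g := by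
      intro z
      by_cases hz : z = 0
      · exact ⟨0, fun g hg => absurd (by simp [hz]) hg⟩
      · exact ⟨w z.order, fun g hg => hw (HahnSeries.order_le_of_coeff_ne_zero hg)⟩
    intro x y hx hy C
    obtain ⟨m, hm⟩ := key x
    obtain ⟨m', hm'⟩ := key y
    refine (((hx (C - m')).prod (hy (C - m))).image (fun p => p.1 + p.2)).subset ?_
    rintro g ⟨hg, hC⟩
    have hg' : g ∈ (x * y).support := hg
    obtain ⟨a, ha, b, hb, rfl⟩ := HahnSeries.support_mul_subset hg'
    have ha' := hm a ha
    have hb' := hm' b hb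
    have hab : w (a + b) < C := hC
    rw [map_add] at hab
    exact ⟨(a, b), ⟨⟨ha, by linarith⟩, ⟨hb, by linarith⟩⟩, rfl⟩

theorem single_mem_novikovSubalgebra (w : G →+ ℝ) (hw : Monotone w) (g : G) :
    HahnSeries.single g (1 : κ) ∈ novikovSubalgebra κ w hw := by
  intro C
  refine (Set.finite_singleton g).subset ?_
  rintro g' ⟨hg', -⟩
  by_contra h
  exact hg' (HahnSeries.coeff_single_of_ne h)

/-- The homomorphism `κ[G] → novikovSubalgebra` sending `T^g` to the series `T^g`. -/
def toNovikov (w : G →+ ℝ) (hw : Monotone w) :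
    AddMonoidAlgebra κ G →ₐ[κ] novikovSubalgebra κ w hw :=
  AddMonoidAlgebra.lift κ (novikovSubalgebra κ w hw) G
    { toFun := fun g => ⟨HahnSeries.single g.toAdd 1, single_mem_novikovSubalgebra κ w hw _⟩
      map_one' := rfl
      map_mul' := fun a b => Subtype.ext (by simp) }

theorem toNovikov_single (w : G →+ ℝ) (hw : Monotone w) (g : G) (r : κ) :
    (toNovikov κ w hw (AddMonoidAlgebra.single g r)).1 = HahnSeries.single g r := by
  rw [toNovikov, AddMonoidAlgebra.lift_single]
  change r • HahnSeries.single g (1 : κ) = _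
  ext g'
  rw [HahnSeries.coeff_smul, smul_eq_mul]
  by_cases h : g' = g
  · subst h; simp
  · rw [HahnSeries.coeff_single_of_ne h, HahnSeries.coeff_single_of_ne h, mul_zero]

/-- Reindexing the exponents along an order embedding of groups that preserves the weights. -/
def novikovReindex {G' : Type*} [AddCommGroup G'] [LinearOrder G'] [IsOrderedAddMonoid G']
    (w : G →+ ℝ) (hw : Monotone w) (w' : G' →+ ℝ) (hw' : Monotone w') (f : G →+ G')
    (hfi : Function.Injective f) (hf : ∀ a b, f a ≤ f b ↔ a ≤ b) (hww : ∀ a, w' (f a) = w a) :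
    novikovSubalgebra κ w hw →+* novikovSubalgebra κ w' hw' :=
  ((HahnSeries.embDomainRingHom f hfi hf).comp
    (novikovSubalgebra κ w hw).val.toRingHom).codRestrict (novikovSubalgebra κ w' hw') (by
      intro x C
      refine ((x.2 C).image f).subset ?_
      rintro g ⟨hg, hC⟩
      obtain ⟨a, ha, rfl⟩ := HahnSeries.support_embDomain_subset
        (f := ⟨⟨f, hfi⟩, hf _ _⟩) (x := x.1) hg
      exact ⟨a, ⟨ha, by rw [← hww a]; exact hC⟩, rfl⟩)

theorem novikovReindex_coeff {G' : Type*} [AddCommGroup G'] [LinearOrder G']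
    [IsOrderedAddMonoid G'] (w : G →+ ℝ) (hw : Monotone w) (w' : G' →+ ℝ) (hw' : Monotone w')
    (f : G →+ G') (hfi : Function.Injective f) (hf : ∀ a b, f a ≤ f b ↔ a ≤ b)
    (hww : ∀ a, w' (f a) = w a) (x : novikovSubalgebra κ w hw) (a : G) :
    (novikovReindex κ w hw w' hw' f hfi hf hww x).1.coeff (f a) = x.1.coeff a :=
  HahnSeries.embDomain_coeff (f := ⟨⟨f, hfi⟩, hf _ _⟩) (x := x.1) (a := a)

theorem novikovReindex_single {G' : Type*} [AddCommGroup G'] [LinearOrder G']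
    [IsOrderedAddMonoid G'] (w : G →+ ℝ) (hw : Monotone w) (w' : G' →+ ℝ) (hw' : Monotone w')
    (f : G →+ G') (hfi : Function.Injective f) (hf : ∀ a b, f a ≤ f b ↔ a ≤ b)
    (hww : ∀ a, w' (f a) = w a) (a : G) (r : κ) :
    novikovReindex κ w hw w' hw' f hfi hf hww
        (toNovikov κ w hw (AddMonoidAlgebra.single a r)) =
      toNovikov κ w' hw' (AddMonoidAlgebra.single (f a) r) := by
  apply Subtype.ext
  rw [toNovikov_single]
  change HahnSeries.embDomain _ (toNovikov κ w hw (AddMonoidAlgebra.single a r)).1 = _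
  rw [toNovikov_single, HahnSeries.embDomain_single]
  rfl

end NovikovSubalgebra

section Rings

variable (κ : Type*) [Field κ] (Γ : AddSubgroup ℝ)

/-- `Λ = κ[Γ]`. -/
abbrev Lam : Type _ := AddMonoidAlgebra κ Γ

/-- The exponent weight `g ↦ g`. -/
def weightUp : Γ →+ ℝ := Γ.subtype

/-- The exponent weight `g ↦ -g` on `Γ` with the reversed order. -/
def weightDown : (Γᵒᵈ) →+ ℝ where
  toFun g := -((OrderDual.ofDual g : Γ) : ℝ)
  map_zero' := by simp
  map_add' a b := by simp; ring

theorem weightUp_mono : Monotone (weightUp Γ) := fun _ _ h => h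

theorem weightDown_mono : Monotone (weightDown Γ) := fun a b h => by
  have : (OrderDual.ofDual b : Γ) ≤ OrderDual.ofDual a := h
  exact neg_le_neg (Subtype.coe_le_coe.mpr this)

/-- `Λ_↑`: series `∑ a_g T^g`, `g ∈ Γ`, with `{g | a_g ≠ 0, g < C}` finite for all real `C`. -/
def LamUp : Type _ := novikovSubalgebra κ (weightUp Γ) (weightUp_mono Γ)

/-- `Λ^↓`: series `∑ a_g T^g`, `g ∈ Γ`, with `{g | a_g ≠ 0, g > -C}` finite for all real `C`.
They are realized as Hahn series for the reversed order on `Γ`. -/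
def LamDown : Type _ := novikovSubalgebra κ (weightDown Γ) (weightDown_mono Γ)

instance : CommRing (LamUp κ Γ) :=
  inferInstanceAs (CommRing (novikovSubalgebra κ (weightUp Γ) (weightUp_mono Γ)))

instance : CommRing (LamDown κ Γ) :=
  inferInstanceAs (CommRing (novikovSubalgebra κ (weightDown Γ) (weightDown_mono Γ)))

/-- The inclusion `Λ → Λ_↑`. -/
def incUp : Lam κ Γ →+* LamUp κ Γ :=
  (toNovikov κ (weightUp Γ) (weightUp_mono Γ)).toRingHom

/-- The inclusion `Λ → Λ^↓`, `T^g ↦ T^g`. -/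
def incDown : Lam κ Γ →+* LamDown κ Γ :=
  (toNovikov κ (weightDown Γ) (weightDown_mono Γ)).toRingHom.comp
    (AddMonoidAlgebra.mapDomainRingHom κ
      ({ toFun := OrderDual.toDual, map_zero' := rfl, map_add' := fun _ _ => rfl } : Γ →+ Γᵒᵈ))

instance : Algebra (Lam κ Γ) (LamUp κ Γ) := (incUp κ Γ).toAlgebra

instance : Algebra (Lam κ Γ) (LamDown κ Γ) := (incDown κ Γ).toAlgebra

variable {κ Γ}

/-- The coefficient of `T^g` in an element of `Λ_↑`. -/
def LamUp.coeff (x : LamUp κ Γ) (g : Γ) : κ := x.1.coeff g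

/-- The coefficient of `T^g` in an element of `Λ^↓`. -/
def LamDown.coeff (x : LamDown κ Γ) (g : Γ) : κ := x.1.coeff (OrderDual.toDual g)

/-- `ν_↑(∑ a_g T^g) = min {g | a_g ≠ 0}`, with value `∞` at `0`. -/
def nuUp (x : LamUp κ Γ) : EReal := ⨅ (g : Γ) (_ : x.coeff g ≠ 0), ((g : ℝ) : EReal)

/-- `ν^↓(∑ a_g T^g) = max {g | a_g ≠ 0}`, with value `-∞` at `0`. -/
def nuDown (x : LamDown κ Γ) : EReal := ⨆ (g : Γ) (_ : x.coeff g ≠ 0), ((g : ℝ) : EReal)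

variable (κ Γ)

/-- Conjugation `∑ a_g T^g ↦ ∑ a_g T^{-g}` on `Λ`. -/
def conj : Lam κ Γ →+* Lam κ Γ :=
  AddMonoidAlgebra.mapDomainRingHom κ (negAddMonoidHom : Γ →+ Γ)

/-- Negation, from `Γ` with the reversed order to `Γ`. -/
def negDual : Γᵒᵈ →+ Γ where
  toFun g := -(OrderDual.ofDual g)
  map_zero' := by simp
  map_add' a b := by simp; abel

theorem negDual_injective : Function.Injective (negDual Γ) := fun _ _ h =>
  OrderDual.ofDual.injective (neg_injective h)

theorem negDual_le_iff (a b : Γᵒᵈ) : negDual Γ a ≤ negDual Γ b ↔ a ≤ b :=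
  neg_le_neg_iff

/-- Conjugation `∑ a_g T^g ↦ ∑ a_g T^{-g}` from `Λ^↓` to `Λ_↑`. -/
def conjDown : LamDown κ Γ →+* LamUp κ Γ :=
  novikovReindex κ (weightDown Γ) (weightDown_mono Γ) (weightUp Γ) (weightUp_mono Γ)
    (negDual Γ) (negDual_injective Γ) (negDual_le_iff Γ) (fun _ => rfl)

theorem conjDown_coeff (x : LamDown κ Γ) (g : Γ) : (conjDown κ Γ x).coeff g = x.coeff (-g) := by
  have h := novikovReindex_coeff κ (weightDown Γ) (weightDown_mono Γ) (weightUp Γ)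
    (weightUp_mono Γ) (negDual Γ) (negDual_injective Γ) (negDual_le_iff Γ) (fun _ => rfl) x
    (OrderDual.toDual (-g))
  have h2 : negDual Γ (OrderDual.toDual (-g)) = g := neg_neg g
  rw [h2] at h
  exact h

theorem conjDown_incDown (x : Lam κ Γ) :
    conjDown κ Γ (incDown κ Γ x) = incUp κ Γ (conj κ Γ x) := by
  have hs : ∀ (g : Γ) (r : κ), conjDown κ Γ (incDown κ Γ (AddMonoidAlgebra.single g r)) =
      incUp κ Γ (conj κ Γ (AddMonoidAlgebra.single g r)) := by
    intro g r
    have h := novikovReindex_single κ (weightDown Γ) (weightDown_mono Γ) (weightUp Γ)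
      (weightUp_mono Γ) (negDual Γ) (negDual_injective Γ) (negDual_le_iff Γ) (fun _ => rfl)
      (OrderDual.toDual g) r
    have h1 : incDown κ Γ (AddMonoidAlgebra.single g r) = toNovikov κ (weightDown Γ)
        (weightDown_mono Γ) (AddMonoidAlgebra.single (OrderDual.toDual g) r) :=
      congrArg (toNovikov κ (weightDown Γ) (weightDown_mono Γ)) (by simp; rfl)
    have h2 : conj κ Γ (AddMonoidAlgebra.single g r) = AddMonoidAlgebra.single (-g) r := by
      simp [conj]
    rw [h1, h2]
    exact h
  have h : (conjDown κ Γ).comp (incDown κ Γ) = (incUp κ Γ).comp (conj κ Γ) :=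
    AddMonoidAlgebra.ringHom_ext (fun r => hs 0 r) (fun g => hs g 1)
  exact congrArg (fun f => f x) h

end Rings

/-! ### Conjugated duals -/

section Duals

variable (κ : Type*) [Field κ] (Γ : AddSubgroup ℝ)

/-- The conjugated dual `ᵛM` of a `Λ`-module: `Hom_Λ(M, Λ)` on which `λ` acts as multiplication
by the conjugate of `λ`. -/
def ConjDual (M : Type*) [AddCommGroup M] [Module (Lam κ Γ) M] : Type _ :=
  Module.Dual (Lam κ Γ) M

/-- The conjugated dual `ᵛV` of a `Λ_↑`-vector space: `Hom(V, Λ_↑)` regarded as a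
`Λ^↓`-vector space, with `μ ∈ Λ^↓` acting as multiplication by the conjugate of `μ`. -/
def NovDual (V : Type*) [AddCommGroup V] [Module (LamUp κ Γ) V] : Type _ :=
  Module.Dual (LamUp κ Γ) V

section ConjDual

variable (M : Type*) [AddCommGroup M] [Module (Lam κ Γ) M]

instance : AddCommGroup (ConjDual κ Γ M) :=
  inferInstanceAs (AddCommGroup (Module.Dual (Lam κ Γ) M))

instance : Module (Lam κ Γ) (ConjDual κ Γ M) :=
  Module.compHom (Module.Dual (Lam κ Γ) M) (conj κ Γ)

instance : FunLike (ConjDual κ Γ M) M (Lam κ Γ) :=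
  inferInstanceAs (FunLike (Module.Dual (Lam κ Γ) M) M (Lam κ Γ))

theorem ConjDual.smul_apply (c : Lam κ Γ) (ζ : ConjDual κ Γ M) (x : M) :
    (c • ζ) x = conj κ Γ c * ζ x := rfl

end ConjDual

section NovDual

variable (V : Type*) [AddCommGroup V] [Module (LamUp κ Γ) V]

instance : AddCommGroup (NovDual κ Γ V) :=
  inferInstanceAs (AddCommGroup (Module.Dual (LamUp κ Γ) V))

instance : Module (LamDown κ Γ) (NovDual κ Γ V) :=
  Module.compHom (Module.Dual (LamUp κ Γ) V) (conjDown κ Γ)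

instance : Module (Lam κ Γ) (NovDual κ Γ V) :=
  Module.compHom (NovDual κ Γ V) (algebraMap (Lam κ Γ) (LamDown κ Γ))

instance : FunLike (NovDual κ Γ V) V (LamUp κ Γ) :=
  inferInstanceAs (FunLike (Module.Dual (LamUp κ Γ) V) V (LamUp κ Γ))

theorem NovDual.smul_apply (c : LamDown κ Γ) (ζ : NovDual κ Γ V) (x : V) :
    (c • ζ) x = conjDown κ Γ c * ζ x := rfl

instance : IsScalarTower (Lam κ Γ) (LamDown κ Γ) (NovDual κ Γ V) where
  smul_assoc c d ζ := by
    rw [Algebra.smul_def, mul_smul]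
    rfl

end NovDual

variable {κ Γ}
variable {H V : Type*} [AddCommGroup H] [Module (Lam κ Γ) H]
  [AddCommGroup V] [Module (LamUp κ Γ) V] [Module (Lam κ Γ) V]
  [IsScalarTower (Lam κ Γ) (LamUp κ Γ) V]

/-- The `Λ_↑`-linear functional on `V` whose value at each `S h` is `ζ h`. -/
def dualLift {S : H →ₗ[Lam κ Γ] V} (hS : IsBaseChange (LamUp κ Γ) S) (ζ : ConjDual κ Γ H) :
    Module.Dual (LamUp κ Γ) V :=
  hS.lift ((Algebra.linearMap (Lam κ Γ) (LamUp κ Γ)).comp (show Module.Dual (Lam κ Γ) H from ζ))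

theorem dualLift_apply {S : H →ₗ[Lam κ Γ] V} (hS : IsBaseChange (LamUp κ Γ) S)
    (ζ : ConjDual κ Γ H) (h : H) :
    dualLift hS ζ (S h) = algebraMap (Lam κ Γ) (LamUp κ Γ) (ζ h) :=
  hS.lift_eq _ h

/-- For `S : H → V` inducing an isomorphism `Λ_↑ ⊗ H ≅ V`, the map `ᵛH → ᵛV` sending `ζ` to the
unique `Λ_↑`-linear functional on `V` whose value at each `S h` is `ζ h`. -/
def dualExtension {S : H →ₗ[Lam κ Γ] V} (hS : IsBaseChange (LamUp κ Γ) S) :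
    ConjDual κ Γ H →ₗ[Lam κ Γ] NovDual κ Γ V where
  toFun := dualLift hS
  map_add' ζ ξ := hS.algHom_ext (Q := LamUp κ Γ) (dualLift hS (ζ + ξ))
    (dualLift hS ζ + dualLift hS ξ) fun h => by
      rw [LinearMap.add_apply, dualLift_apply, dualLift_apply, dualLift_apply]
      exact map_add (algebraMap (Lam κ Γ) (LamUp κ Γ)) (ζ h) (ξ h)
  map_smul' c ζ := hS.algHom_ext (Q := LamUp κ Γ) (dualLift hS (c • ζ))
    (conjDown κ Γ (incDown κ Γ c) • dualLift hS ζ) fun h => by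
      rw [LinearMap.smul_apply, dualLift_apply, dualLift_apply, conjDown_incDown]
      exact map_mul (algebraMap (Lam κ Γ) (LamUp κ Γ)) (conj κ Γ c) (ζ h)

theorem dualExtension_apply {S : H →ₗ[Lam κ Γ] V} (hS : IsBaseChange (LamUp κ Γ) S)
    (ζ : ConjDual κ Γ H) (h : H) :
    dualExtension hS ζ (S h) = algebraMap (Lam κ Γ) (LamUp κ Γ) (ζ h) :=
  dualLift_apply hS ζ h

end Duals

/-! ### Filtrations, orthogonality and basis spectra -/

section Filtered

variable (κ : Type*) [Field κ] (Γ : AddSubgroup ℝ)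

/-- The axioms of a filtration function `ρ : V → ℝ ∪ {-∞}` on a `Λ_↑`-vector space. -/
structure IsNormUp {V : Type*} [AddCommGroup V] [Module (LamUp κ Γ) V] (ρ : V → EReal) :
    Prop where
  ne_top : ∀ x, ρ x ≠ ⊤
  eq_bot_iff : ∀ x, ρ x = ⊥ ↔ x = 0
  smul : ∀ (c : LamUp κ Γ) (x : V), ρ (c • x) = ρ x - nuUp c
  add_le : ∀ x y, ρ (x + y) ≤ max (ρ x) (ρ y)

variable {κ Γ} in
/-- `ᵛρ(ζ) = inf_{x ≠ 0} (ν_↑(ζ x) + ρ x)`, the filtration function on `ᵛV` induced by `ρ`. -/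
def dualNorm {V : Type*} [AddCommGroup V] [Module (LamUp κ Γ) V] (ρ : V → EReal)
    (ζ : NovDual κ Γ V) : EReal :=
  ⨅ (x : V) (_ : x ≠ 0), nuUp (ζ x) + ρ x

/-- `v` is a `ρ`-orthogonal basis of the `Λ_↑`-vector space `V`. -/
structure IsOrthogonalBasisUp {V : Type*} [AddCommGroup V] [Module (LamUp κ Γ) V]
    (ρ : V → EReal) {d : ℕ} (v : Fin d → V) : Prop where
  linearIndependent : LinearIndependent (LamUp κ Γ) v
  span_eq_top : Submodule.span (LamUp κ Γ) (Set.range v) = ⊤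
  orthogonal : ∀ c : Fin d → LamUp κ Γ, ρ (∑ i, c i • v i) = ⨆ i, (ρ (v i) - nuUp (c i))

/-- `v` is a `ρ`-orthogonal basis of the `Λ^↓`-vector space `V`. -/
structure IsOrthogonalBasisDown {V : Type*} [AddCommGroup V] [Module (LamDown κ Γ) V]
    (ρ : V → EReal) {d : ℕ} (v : Fin d → V) : Prop where
  linearIndependent : LinearIndependent (LamDown κ Γ) v
  span_eq_top : Submodule.span (LamDown κ Γ) (Set.range v) = ⊤
  orthogonal : ∀ c : Fin d → LamDown κ Γ, ρ (∑ i, c i • v i) = ⨅ i, (ρ (v i) - nuDown (c i))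

variable {κ Γ}

section MatchedPair

variable {H Vup Vdown : Type*} [AddCommGroup H] [Module (Lam κ Γ) H]
  [AddCommGroup Vup] [Module (LamUp κ Γ) Vup] [Module (Lam κ Γ) Vup]
  [AddCommGroup Vdown] [Module (LamDown κ Γ) Vdown] [Module (Lam κ Γ) Vdown]

/-- `e` is a doubly-orthogonal basis for the pair of maps `φup : H → (Vup, ρup)` and
`φdown : H → (Vdown, ρdown)`. -/
structure IsDoublyOrthogonalBasis (φup : H →ₗ[Lam κ Γ] Vup) (ρup : Vup → EReal)
    (φdown : H →ₗ[Lam κ Γ] Vdown) (ρdown : Vdown → EReal) {d : ℕ} (e : Fin d → H) : Prop where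
  linearIndependent :
    LinearIndependent (Lam κ Γ) fun i => (Submodule.torsion (Lam κ Γ) H).mkQ (e i)
  span_eq_top :
    Submodule.span (Lam κ Γ)
      (Set.range fun i => (Submodule.torsion (Lam κ Γ) H).mkQ (e i)) = ⊤
  up : IsOrthogonalBasisUp κ Γ ρup fun i => φup (e i)
  down : IsOrthogonalBasisDown κ Γ ρdown fun i => φdown (e i)

/-- `spec` is the basis spectrum of the pair of maps `φup`, `φdown`: the multiset of the pairs
`([ρup(φup e_i)], ρdown(φdown e_i) - ρup(φup e_i))` in `(ℝ/Γ) × ℝ` for a doubly-orthogonal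
basis `(e_i)`. -/
def IsBasisSpectrum (φup : H →ₗ[Lam κ Γ] Vup) (ρup : Vup → EReal)
    (φdown : H →ₗ[Lam κ Γ] Vdown) (ρdown : Vdown → EReal)
    (spec : Multiset ((ℝ ⧸ Γ) × ℝ)) : Prop :=
  ∃ (d : ℕ) (e : Fin d → H) (a b : Fin d → ℝ),
    IsDoublyOrthogonalBasis φup ρup φdown ρdown e ∧
    (∀ i, ρup (φup (e i)) = (a i : EReal)) ∧
    (∀ i, ρdown (φdown (e i)) = (b i : EReal)) ∧
    spec = Finset.univ.val.map fun i => ((QuotientAddGroup.mk (a i) : ℝ ⧸ Γ), b i - a i)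

end MatchedPair

end Filtered

/-! ### Intervals modulo translation -/

section Intervals

/-- Nonempty intervals in `ℝ`, of any type. -/
def RealInterval : Type := {I : Set ℝ // I.Nonempty ∧ I.OrdConnected}

variable (Γ : AddSubgroup ℝ)

/-- Two intervals are equivalent if one is the translate of the other by an element of `Γ`. -/
def translationSetoid : Setoid RealInterval where
  r I J := ∃ g ∈ Γ, (fun x => x + g) '' I.1 = J.1
  iseqv :=
    { refl := fun I => ⟨0, Γ.zero_mem, by simp⟩
      symm := by
        rintro I J ⟨g, hg, h⟩
        exact ⟨-g, Γ.neg_mem hg, by rw [← h, Set.image_image]; simp⟩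
      trans := by
        rintro I J K ⟨g, hg, h⟩ ⟨g', hg', h'⟩
        exact ⟨g + g', Γ.add_mem hg hg', by
          rw [← h', ← h, Set.image_image]
          simp only [add_assoc]⟩ }

/-- Intervals modulo `Γ`-translation. -/
def Bar : Type := Quotient (translationSetoid Γ)

/-- `[a,b]^Γ`. -/
def closedBar (a b : ℝ) (h : a ≤ b) : Bar Γ :=
  Quotient.mk (translationSetoid Γ) ⟨Set.Icc a b, Set.nonempty_Icc.mpr h, Set.ordConnected_Icc⟩

/-- `(a,b)^Γ`. -/
def openBar (a b : ℝ) (h : a < b) : Bar Γ :=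
  Quotient.mk (translationSetoid Γ) ⟨Set.Ioo a b, Set.nonempty_Ioo.mpr h, Set.ordConnected_Ioo⟩

theorem closedBar_add (a b g : ℝ) (hg : g ∈ Γ) (h : a ≤ b) (h' : a + g ≤ b + g) :
    closedBar Γ a b h = closedBar Γ (a + g) (b + g) h' :=
  Quotient.sound ⟨g, hg, Set.image_add_const_Icc g a b⟩

theorem openBar_add (a b g : ℝ) (hg : g ∈ Γ) (h : a < b) (h' : a + g < b + g) :
    openBar Γ a b h = openBar Γ (a + g) (b + g) h' :=
  Quotient.sound ⟨g, hg, Set.image_add_const_Ioo g a b⟩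

/-- The closed bar `[a, a + ℓ]^Γ` of an element `([a], ℓ)` with `ℓ ≥ 0`. -/
def closedBarOf (p : (ℝ ⧸ Γ) × ℝ) (h : 0 ≤ p.2) : Bar Γ :=
  Quotient.liftOn' p.1 (fun a => closedBar Γ a (a + p.2) (by linarith)) (by
    intro a b hab
    have hg : -a + b ∈ Γ := QuotientAddGroup.leftRel_apply.mp hab
    have e1 : a + (-a + b) = b := by ring
    have e2 : a + p.2 + (-a + b) = b + p.2 := by ring
    have := closedBar_add Γ a (a + p.2) (-a + b) hg (by linarith) (by linarith)
    simpa only [e1, e2] using this)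

/-- The open bar `(a + ℓ, a)^Γ` of an element `([a], ℓ)` with `ℓ < 0`. -/
def openBarOf (p : (ℝ ⧸ Γ) × ℝ) (h : p.2 < 0) : Bar Γ :=
  Quotient.liftOn' p.1 (fun a => openBar Γ (a + p.2) a (by linarith)) (by
    intro a b hab
    have hg : -a + b ∈ Γ := QuotientAddGroup.leftRel_apply.mp hab
    have e1 : a + (-a + b) = b := by ring
    have e2 : a + p.2 + (-a + b) = b + p.2 := by ring
    have := openBar_add Γ (a + p.2) a (-a + b) hg (by linarith) (by linarith)
    simpa only [e1, e2] using this)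

open Classical in
/-- The multiset of the bars `[a, a + ℓ]^Γ` for the `([a], ℓ)` in `spec` with `ℓ ≥ 0`. -/
def closedBars (spec : Multiset ((ℝ ⧸ Γ) × ℝ)) : Multiset (Bar Γ) :=
  spec.filterMap fun p => if h : 0 ≤ p.2 then some (closedBarOf Γ p h) else none

open Classical in
/-- The multiset of the bars `(a + ℓ, a)^Γ` for the `([a], ℓ)` in `spec` with `ℓ < 0`. -/
def openBars (spec : Multiset ((ℝ ⧸ Γ) × ℝ)) : Multiset (Bar Γ) :=
  spec.filterMap fun p => if h : p.2 < 0 then some (openBarOf Γ p h) else none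

end Intervals

/-! ### Poincaré–Novikov structures -/

section PoincareNovikovStructures

variable (κ : Type*) [Field κ] (Γ : AddSubgroup ℝ)

/-- A weak `n`-PD structure on the graded `Λ`-module `⨁ H_k`. The map `D_k : H_k → ᵛH_{n-k}` is
`D k j h` with `h : k + j = n`. -/
structure WeakPDStructure (n : ℤ) (H : ℤ → Type*) [∀ k, AddCommGroup (H k)]
    [∀ k, Module (Lam κ Γ) (H k)] where
  finite : ∀ k, Module.Finite (Lam κ Γ) (H k)
  D : ∀ k j : ℤ, k + j = n → H k →ₗ[Lam κ Γ] ConjDual κ Γ (H j)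
  symmetric : ∀ (k j : ℤ) (h : k + j = n) (h' : j + k = n),
    (∀ x y, D k j h x y = conj κ Γ (D j k h' y x)) ∨
    (∀ x y, D k j h x y = -conj κ Γ (D j k h' y x))
  bijective : ∀ (k j : ℤ) (h : k + j = n), Function.Bijective
    (LinearMap.baseChange (FractionRing (Lam κ Γ)) (D k j h))

variable {κ Γ} {n : ℤ} {H : ℤ → Type*} [∀ k, AddCommGroup (H k)] [∀ k, Module (Lam κ Γ) (H k)]

/-- The remaining data of a weak `n`-Poincaré–Novikov structure whose modules `H_k` and duality
morphisms `D_k` are those of the weak `n`-PD structure `P`. The `Λ`-module structure of `V_k` is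
the restriction of its `Λ_↑`-vector space structure. -/
structure WeakPNStructure (P : WeakPDStructure κ Γ n H) where
  V : ℤ → Type*
  [addCommGroup : ∀ k, AddCommGroup (V k)]
  [moduleUp : ∀ k, Module (LamUp κ Γ) (V k)]
  [module : ∀ k, Module (Lam κ Γ) (V k)]
  [tower : ∀ k, IsScalarTower (Lam κ Γ) (LamUp κ Γ) (V k)]
  finite : ∀ k, Module.Finite (LamUp κ Γ) (V k)
  ρ : ∀ k, V k → EReal
  isNormUp : ∀ k, IsNormUp κ Γ (ρ k)
  S : ∀ k, H k →ₗ[Lam κ Γ] V k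
  isBaseChange : ∀ k, IsBaseChange (LamUp κ Γ) (S k)

attribute [instance] WeakPNStructure.addCommGroup WeakPNStructure.moduleUp
  WeakPNStructure.module WeakPNStructure.tower

namespace WeakPNStructure

variable {P : WeakPDStructure κ Γ n H}

/-- The map `H_k → ᵛ(V_{n-k})` obtained from `D_k` and `S_{n-k}`. -/
def Stilde (N : WeakPNStructure P) (k : ℤ) : H k →ₗ[Lam κ Γ] NovDual κ Γ (N.V (n - k)) :=
  (dualExtension (N.isBaseChange (n - k))).comp (P.D k (n - k) (by ring))

theorem Stilde_apply (N : WeakPNStructure P) (k : ℤ) (x : H k) (y : H (n - k)) :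
    N.Stilde k x (N.S (n - k) y) =
      algebraMap (Lam κ Γ) (LamUp κ Γ) (P.D k (n - k) (by ring) x y) :=
  dualExtension_apply _ _ _

/-- `spec` is the basis spectrum of the filtered matched pair given by
`S_k : H_k → (V_k, ρ_k)` and `S̃_k : H_k → (ᵛ(V_{n-k}), ᵛρ_{n-k})`. -/
def IsSpectrum (N : WeakPNStructure P) (k : ℤ) (spec : Multiset ((ℝ ⧸ Γ) × ℝ)) : Prop :=
  IsBasisSpectrum (N.S k) (N.ρ k) (N.Stilde k) (dualNorm (N.ρ (n - k))) spec

/-- `B` is the essential barcode of `N`: the degree `k` part consists of the `[a, a + ℓ]^Γ` for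
`([a], ℓ)` in the `k`th basis spectrum with `ℓ ≥ 0`, and of the `(a + ℓ, a)^Γ` for `([a], ℓ)` in
the `(k+1)`st basis spectrum with `ℓ < 0`. -/
def IsEssentialBarcode (N : WeakPNStructure P) (B : ℤ → Multiset (Bar Γ)) : Prop :=
  ∃ spec : ℤ → Multiset ((ℝ ⧸ Γ) × ℝ), (∀ k, N.IsSpectrum k (spec k)) ∧
    ∀ k, B k = closedBars Γ (spec k) + openBars Γ (spec (k + 1))

/-- A `t`-morphism from `N` to `N'`. -/
structure TMorphism (N : WeakPNStructure P) (N' : WeakPNStructure P) (t : ℝ) where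
  a : ∀ k, N.V k ≃ₗ[LamUp κ Γ] N'.V k
  comp : ∀ k x, N'.S k x = a k (N.S k x)
  le_add : ∀ k x, N'.ρ k (a k x) ≤ N.ρ k x + (t : EReal)
  le_add' : ∀ k x, N.ρ k x ≤ N'.ρ k (a k x) + (t : EReal)

end WeakPNStructure

open Classical in
/-- The set of all bars of a graded barcode, with each bar repeated according to its
multiplicity and labelled by its degree. -/
def AllBars (B : ℤ → Multiset (Bar Γ)) : Type := Σ k : ℤ, (B k).ToType

/-- The degree of a bar. -/
def AllBars.degree {B : ℤ → Multiset (Bar Γ)} (x : AllBars B) : ℤ := x.1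

/-- The underlying interval modulo `Γ`-translation of a bar. -/
def AllBars.bar {B : ℤ → Multiset (Bar Γ)} (x : AllBars B) : Bar Γ := x.2.1

end PoincareNovikovStructures

end PoincareNovikov

end

noncomputable section

namespace PoincareNovikov

/-! ### Discrete subgroups of the reals and their group algebras -/

section Discrete

variable (Γ : AddSubgroup ℝ) [DiscreteTopology Γ]

/-! Existence of bases. A discrete Γ is cyclic, so Λ is a principal ideal ring and F = H_k/torsion
is free of finite rank. On F consider p = ρ_k ∘ S_k and q = -ᵛρ_{n-k} ∘ S̃_k. Both are ultrametric;
multiplication by T^g changes p by -g and q by +g, which is recorded as a weight s = 1 or s = -1.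
The sum p + q is therefore unchanged by monomials. Its values lie in finitely many cosets of Γ and
are bounded below, so it has a minimum at some e ≠ 0 (`exists_minimal_add`). Minimality has two
consequences. If e = c·y, then p + q drops from e to y by at least the width of the support of c, so
c is a monomial, hence a unit, and F/Λe is again free (`isTorsionFree_quotient_of_minimal`).
Moreover a p-optimal lift and a q-optimal lift of the same vector of F/Λe can be merged into one
lift optimal for both (`exists_common_lift`). Induction on the rank gives a common orthogonal basis
(`exists_common_orthogonal`).

Two facts connect this with the Novikov fields. Every functional on F is bounded by p and by q: for
p because functionals on a finite-dimensional filtered space are bounded (`exists_functional_bound`,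
a completeness argument), for q because D_{n-k} represents every functional on H_k up to a
denominator. Orthogonality over Λ passes to Λ_↑ by truncating coefficients
(`eq_iSup_of_orthogonal`), and to Λ^↓ by conjugation.

Stability. Doubly-orthogonal bases of N and N' in degree k are two bases of the same module F, so
the transition matrices A and B are inverse to each other over Λ. A monomial T^g in an entry forces
one inequality between the values a, a' and one between the values b, b', up to g and t
(`coeff_bound`). Hall's theorem turns this into a matching (`exists_matching`): if X is a set of
indices and Y the set of its possible partners, then the products B_ij A_ji' with j outside Y vanish
whenever the length b - a of i' is at most that of i. So the block of B with rows X and columns Y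
has a triangular product with A and independent rows, whence |X| ≤ |Y|. Matched elements have both
endpoints within t after a common translation; a change of sign of b - a exchanges a closed bar in
degree k with an open bar in degree k - 1. -/

theorem finite_setOf_mem_Icc (m M : ℝ) : {g : Γ | m ≤ g ∧ (g : ℝ) ≤ M}.Finite := by
  have hcl : IsClosed (Γ : Set ℝ) := AddSubgroup.isClosed_of_discrete
  have hK : IsCompact ((Γ : Set ℝ) ∩ Set.Icc m M) := isCompact_Icc.inter_left hcl
  have hd : IsDiscrete ((Γ : Set ℝ) ∩ Set.Icc m M) :=
    (⟨inferInstanceAs (DiscreteTopology Γ)⟩ : IsDiscrete (Γ : Set ℝ)).mono Set.inter_subset_left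
  have hf := hK.finite hd
  exact (hf.preimage Subtype.val_injective.injOn).subset fun g hg => ⟨g.2, hg⟩

/-- A nonempty set of reals that is bounded below and meets finitely many cosets of a discrete
subgroup has a least element. -/
theorem exists_isLeast_of_finite_mk {S : Set ℝ} (hne : S.Nonempty) (hb : BddBelow S)
    (hfin : ((QuotientAddGroup.mk : ℝ → ℝ ⧸ Γ) '' S).Finite) : ∃ a, IsLeast S a := by
  obtain ⟨L, hL⟩ := hb
  obtain ⟨m, hm⟩ := hne
  -- `R` picks one representative per coset met by `S`; each coset r + Γ meets [L, m] in a finite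
  -- set.
  have hT : (S ∩ Set.Iic m).Finite := by
    obtain ⟨R, hRS, hR⟩ := (Set.exists_subset_bijOn S (QuotientAddGroup.mk : ℝ → ℝ ⧸ Γ))
    have hRf : R.Finite := by
      refine Set.Finite.of_finite_image ?_ hR.injOn
      rw [hR.image_eq]; exact hfin
    refine (hRf.biUnion fun r _ => (finite_setOf_mem_Icc Γ (L - r) (m - r)).image
      fun g : Γ => r + (g : ℝ)).subset ?_
    rintro x ⟨hx, hxm⟩
    have : (QuotientAddGroup.mk x : ℝ ⧸ Γ) ∈ QuotientAddGroup.mk '' S := ⟨x, hx, rfl⟩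
    obtain ⟨r, hr, hrx⟩ := hR.surjOn this
    have hg : -r + x ∈ Γ := QuotientAddGroup.eq.mp hrx
    have := hL hx
    simp only [Set.mem_Iic] at hxm
    refine Set.mem_biUnion hr ⟨⟨-r + x, hg⟩, ⟨?_, ?_⟩, ?_⟩
    · simp; linarith
    · simp; linarith
    · simp
  obtain ⟨a, ha, hmin⟩ := hT.exists_minimalFor id _ ⟨m, hm, le_refl m⟩
  refine ⟨a, ha.1, fun x hx => ?_⟩
  rcases le_total x m with h | h
  · by_contra hlt
    exact hlt (hmin ⟨hx, h⟩ (not_le.mp hlt).le)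
  · exact ha.2.trans h

/-- Every ideal of a localization is the extension of its contraction, and a generator extends to a
generator. -/
theorem isPrincipalIdealRing_of_isLocalization {R S : Type*} [CommRing R] [CommRing S]
    [Algebra R S] (M : Submonoid R) [IsLocalization M S] [IsPrincipalIdealRing R] :
    IsPrincipalIdealRing S := by
  refine ⟨fun J => ?_⟩
  obtain ⟨a, ha⟩ := (IsPrincipalIdealRing.principal (Ideal.under R J)).principal
  refine ⟨algebraMap R S a, ?_⟩
  rw [← IsLocalization.map_under M S J, ha]
  change Ideal.map (algebraMap R S) (Ideal.span {a}) = Ideal.span {algebraMap R S a}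
  rw [Ideal.map_span, Set.image_singleton]

/-- A subgroup of ℝ is dense or cyclic, and a dense closed one would be ℝ, which meets [0, 1] in
infinitely many points. Hence Λ is a quotient of the Laurent polynomials, themselves a localization
of κ[X]. Only surjectivity of ℤ → Γ is needed, so Γ = 0 is covered. -/
instance isPrincipalIdealRing_lam (κ : Type*) [Field κ] : IsPrincipalIdealRing (Lam κ Γ) := by
  have hnd : ∃ a : ℝ, Γ = AddSubgroup.closure {a} := by
    refine Γ.dense_or_cyclic.resolve_left fun hd => ?_
    have hcl : IsClosed (Γ : Set ℝ) := AddSubgroup.isClosed_of_discrete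
    have huniv : (Γ : Set ℝ) = Set.univ := by rw [← hcl.closure_eq]; exact hd.closure_eq
    have hfin := (finite_setOf_mem_Icc Γ 0 1).image Subtype.val
    refine (Set.Icc_infinite (zero_lt_one (α := ℝ))) (hfin.subset fun x hx => ?_)
    have hxΓ : x ∈ (Γ : Set ℝ) := huniv ▸ Set.mem_univ x
    exact ⟨⟨x, hxΓ⟩, hx, rfl⟩
  obtain ⟨a, ha⟩ := hnd
  have haΓ : a ∈ Γ := ha ▸ AddSubgroup.subset_closure rfl
  let f : ℤ →+ Γ := zmultiplesHom Γ ⟨a, haΓ⟩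
  have hf : Function.Surjective f := by
    rintro ⟨x, hx⟩
    have hx' := hx
    rw [ha, AddSubgroup.mem_closure_singleton] at hx'
    obtain ⟨m, hm⟩ := hx'
    exact ⟨m, Subtype.ext (by simpa [f] using hm)⟩
  have : IsPrincipalIdealRing (LaurentPolynomial κ) :=
    isPrincipalIdealRing_of_isLocalization (Submonoid.powers (Polynomial.X : Polynomial κ))
  refine IsPrincipalIdealRing.of_surjective
    (AddMonoidAlgebra.mapDomainRingHom κ f : LaurentPolynomial κ →+* Lam κ Γ) fun y => ?_
  obtain ⟨z, hz⟩ := Finsupp.mapDomain_surjective hf y.coeff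
  exact ⟨AddMonoidAlgebra.ofCoeff z, AddMonoidAlgebra.coeff_injective hz⟩

end Discrete

/-! ### Weighted norms on modules over the group algebra -/

section WeightedNorm

variable {κ : Type*} [Field κ] {Γ : AddSubgroup ℝ}

/-- An ultrametric function on a `Λ`-module that `T^g` shifts by `-s * g` and that bounds all
linear functionals. -/
structure IsWeightedNorm {F : Type*} [AddCommGroup F] [Module (Lam κ Γ) F] (s : ℝ)
    (p : F → EReal) : Prop where
  map_zero : p 0 = ⊥
  ne_top : ∀ x, p x ≠ ⊤
  add_le : ∀ x y, p (x + y) ≤ max (p x) (p y)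
  single_smul_le : ∀ (g : Γ) (c : κ) (x : F),
    p ((AddMonoidAlgebra.single g c : Lam κ Γ) • x) ≤ p x - ((s * g : ℝ) : EReal)
  bounded : ∀ φ : F →ₗ[Lam κ Γ] Lam κ Γ, ∃ C : ℝ, ∀ (x : F) (g : Γ), (φ x).coeff g ≠ 0 →
    ((-(s * g) - C : ℝ) : EReal) ≤ p x

/-- Orthogonality of a family for a weighted norm, in terms of coefficients in `Λ`. -/
def IsWeightedOrthogonal {F : Type*} [AddCommGroup F] [Module (Lam κ Γ) F] (s : ℝ)
    (p : F → EReal) {d : ℕ} (e : Fin d → F) : Prop :=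
  ∀ (c : Fin d → Lam κ Γ) (i : Fin d) (g : Γ), (c i).coeff g ≠ 0 →
    p (e i) - ((s * g : ℝ) : EReal) ≤ p (∑ j, c j • e j)

theorem sum_single_smul {F : Type*} [AddCommGroup F] [Module (Lam κ Γ) F] (c : Lam κ Γ) (x : F) :
    c • x = ∑ g ∈ c.coeff.support, (AddMonoidAlgebra.single g (c.coeff g) : Lam κ Γ) • x := by
  rw [← Finset.sum_smul]
  congr 1
  exact (AddMonoidAlgebra.sum_coeff_single c).symm

namespace IsWeightedNorm

variable {F : Type*} [AddCommGroup F] [Module (Lam κ Γ) F] {s : ℝ} {p : F → EReal}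
  (hp : IsWeightedNorm (κ := κ) (Γ := Γ) s p)

include hp

theorem map_neg_le (x : F) : p (-x) ≤ p x := by
  have := hp.single_smul_le 0 (-1) x
  have h1 : (AddMonoidAlgebra.single (0 : Γ) (-1 : κ) : Lam κ Γ) = -1 := by
    rw [AddMonoidAlgebra.single_neg]; rfl
  rw [h1] at this
  simpa using this

theorem sub_le (x y : F) : p (x - y) ≤ max (p x) (p y) := by
  rw [sub_eq_add_neg]
  exact (hp.add_le _ _).trans (max_le_max le_rfl (hp.map_neg_le y))

/-- A nonzero monomial is a unit, so the axiom applied to its inverse gives the reverse inequality.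
-/
theorem single_smul (g : Γ) {c : κ} (hc : c ≠ 0) (x : F) :
    p ((AddMonoidAlgebra.single g c : Lam κ Γ) • x) = p x - ((s * g : ℝ) : EReal) := by
  refine le_antisymm (hp.single_smul_le g c x) ?_
  have h := hp.single_smul_le (-g) c⁻¹ ((AddMonoidAlgebra.single g c : Lam κ Γ) • x)
  rw [smul_smul, AddMonoidAlgebra.single_mul_single, neg_add_cancel, inv_mul_cancel₀ hc,
    ← AddMonoidAlgebra.one_def, one_smul] at h
  rw [EReal.sub_le_iff_le_add (Or.inl (EReal.coe_ne_bot _)) (Or.inl (EReal.coe_ne_top _))]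
  refine h.trans (le_of_eq ?_)
  rw [sub_eq_add_neg, ← EReal.coe_neg]
  congr 2
  push_cast
  ring

theorem sum_le {ι : Type*} (T : Finset ι) (y : ι → F) {B : EReal} (h : ∀ t ∈ T, p (y t) ≤ B) :
    p (∑ t ∈ T, y t) ≤ B := by
  classical
  induction T using Finset.induction_on with
  | empty => simp [hp.map_zero]
  | insert a T ha ih =>
    rw [Finset.sum_insert ha]
    exact (hp.add_le _ _).trans (max_le (h _ (Finset.mem_insert_self _ _))
      (ih fun t ht => h t (Finset.mem_insert_of_mem ht)))

theorem sum_lt {ι : Type*} (T : Finset ι) (y : ι → F) {B : EReal} (hB : ⊥ < B)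
    (h : ∀ t ∈ T, p (y t) < B) : p (∑ t ∈ T, y t) < B := by
  classical
  induction T using Finset.induction_on with
  | empty => simpa [hp.map_zero] using hB
  | insert a T ha ih =>
    rw [Finset.sum_insert ha]
    exact (hp.add_le _ _).trans_lt (max_lt (h _ (Finset.mem_insert_self _ _))
      (ih fun t ht => h t (Finset.mem_insert_of_mem ht)))

/-- Terms of pairwise distinct norms cannot cancel: the largest one exceeds the sum of the others.
-/
theorem le_sum_of_injOn {ι : Type*} (T : Finset ι) (y : ι → F) (h : Set.InjOn (fun t => p (y t)) T)
    {t : ι} (ht : t ∈ T) : p (y t) ≤ p (∑ t ∈ T, y t) := by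
  classical
  obtain ⟨m, hm, hmax⟩ := T.exists_max_image (fun t => p (y t)) ⟨t, ht⟩
  refine (hmax t ht).trans ?_
  by_contra! hlt
  have hrest : p (∑ t ∈ T.erase m, y t) < p (y m) := by
    refine hp.sum_lt _ _ (bot_le.trans_lt hlt) fun t ht => ?_
    have ht' := Finset.mem_of_mem_erase ht
    refine lt_of_le_of_ne (hmax t ht') fun heq => ?_
    exact Finset.ne_of_mem_erase ht (h ht' hm heq)
  have := hp.sub_le (∑ t ∈ T, y t) (∑ t ∈ T.erase m, y t)
  rw [← Finset.add_sum_erase T y hm, add_sub_cancel_right, Finset.add_sum_erase T y hm] at this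
  exact absurd this (not_le.mpr (max_lt hlt hrest))

theorem smul_le {c : Lam κ Γ} {x : F} {B : EReal}
    (h : ∀ g, c.coeff g ≠ 0 → p x - ((s * g : ℝ) : EReal) ≤ B) : p (c • x) ≤ B := by
  rw [sum_single_smul]
  exact hp.sum_le _ _ fun g hg =>
    (hp.single_smul_le _ _ _).trans (h g (Finsupp.mem_support_iff.mp hg))

/-- Vectors whose norms lie in distinct cosets of `Γ` are linearly independent. -/
theorem linearIndependent_of_mk_injective (hs : s = 1 ∨ s = -1) {ι : Type*} [Fintype ι] (x : ι → F)
    (a : ι → ℝ) (ha : ∀ i, p (x i) = a i)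
    (hinj : Function.Injective fun i => (QuotientAddGroup.mk (a i) : ℝ ⧸ Γ)) :
    LinearIndependent (Lam κ Γ) x := by
  classical
  have hs0 : s ≠ 0 := by rcases hs with rfl | rfl <;> norm_num
  have hsΓ : ∀ g : Γ, s * g ∈ Γ := by
    rcases hs with rfl | rfl
    · intro g; simp
    · intro g; simp
  rw [Fintype.linearIndependent_iff]
  intro c hc i
  by_contra hci
  obtain ⟨g, hg⟩ : ∃ g, (c i).coeff g ≠ 0 := by
    by_contra! h
    exact hci (AddMonoidAlgebra.coeff_injective (Finsupp.ext h))
  let T : Finset (Σ _ : ι, Γ) := Finset.univ.sigma fun i => (c i).coeff.support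
  let y : (Σ _ : ι, Γ) → F := fun t =>
    (AddMonoidAlgebra.single t.2 ((c t.1).coeff t.2) : Lam κ Γ) • x t.1
  have hval : ∀ t ∈ T, p (y t) = ((a t.1 - s * t.2 : ℝ) : EReal) := by
    intro t ht
    have : (c t.1).coeff t.2 ≠ 0 := Finsupp.mem_support_iff.mp (Finset.mem_sigma.mp ht).2
    simp only [y]
    rw [hp.single_smul _ this, ha, EReal.coe_sub]
  have hsum : ∑ t ∈ T, y t = 0 := by
    rw [Finset.sum_sigma, ← hc]
    exact Finset.sum_congr rfl fun i _ => (sum_single_smul (c i) (x i)).symm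
  have hT : (⟨i, g⟩ : Σ _ : ι, Γ) ∈ T := by simp [T, hg]
  -- The monomial terms have distinct norms: the coset of the norm determines the index, since s·g
  -- lies in Γ, and then the norm itself determines g.
  have := hp.le_sum_of_injOn T y (fun t ht t' ht' h => ?_) hT
  · rw [hsum, hp.map_zero, hval _ hT] at this
    exact EReal.coe_ne_bot _ (le_bot_iff.mp this)
  · simp only at h
    rw [hval t ht, hval t' ht', EReal.coe_eq_coe_iff] at h
    have h1 : t.1 = t'.1 := by
      apply hinj
      rw [QuotientAddGroup.eq]
      have : -a t.1 + a t'.1 = s * t'.2 - s * t.2 := by linarith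
      rw [this]
      exact Γ.sub_mem (hsΓ _) (hsΓ _)
    obtain ⟨i1, g1⟩ := t
    obtain ⟨i2, g2⟩ := t'
    simp only at h1
    subst h1
    have : g1 = g2 := Subtype.ext (mul_left_cancel₀ hs0 (by simp only at h; linarith))
    rw [this]

/-- Vectors realizing different cosets are independent, so there are at most as many cosets as the
rank. -/
theorem finite_mk_values [Module.Finite (Lam κ Γ) F] (hs : s = 1 ∨ s = -1) :
    ((QuotientAddGroup.mk : ℝ → ℝ ⧸ Γ) '' {r | ∃ x, p x = r}).Finite := by
  by_contra hinf
  obtain ⟨t, ht, hcard⟩ := Set.Infinite.exists_subset_card_eq hinf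
    (Module.finrank (Lam κ Γ) F + 1)
  have h : ∀ z : t, ∃ (a : ℝ) (x : F), p x = a ∧ (QuotientAddGroup.mk a : ℝ ⧸ Γ) = z := by
    intro z
    obtain ⟨a, ⟨x, hx⟩, haz⟩ := ht z.2
    exact ⟨a, x, hx, haz⟩
  choose a x hx haz using h
  have hli := hp.linearIndependent_of_mk_injective hs x a hx fun i j hij => by
    simp only [haz] at hij
    exact Subtype.ext hij
  have := hli.fintype_card_le_finrank
  rw [Fintype.card_coe, hcard] at this
  omega

variable [Module.Free (Lam κ Γ) F]

/-- Some coordinate of `x` is nonzero, and boundedness of that coordinate functional excludes the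
value `⊥`. -/
theorem exists_coe_eq {x : F} (hx : x ≠ 0) : ∃ r : ℝ, p x = r := by
  let b := Module.Free.chooseBasis (Lam κ Γ) F
  obtain ⟨i, hi⟩ : ∃ i, b.coord i x ≠ 0 := by
    by_contra! h
    exact hx (b.forall_coord_eq_zero_iff.mp h)
  obtain ⟨C, hC⟩ := hp.bounded (b.coord i)
  obtain ⟨g, hg⟩ : ∃ g, (b.coord i x).coeff g ≠ 0 := by
    by_contra! h
    exact hi (AddMonoidAlgebra.coeff_injective (Finsupp.ext h))
  have h := hC x g hg
  have hbot : p x ≠ ⊥ := fun h0 => by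
    rw [h0] at h
    exact EReal.coe_ne_bot _ (le_bot_iff.mp h)
  exact ⟨(p x).toReal, (EReal.coe_toReal (hp.ne_top x) hbot).symm⟩

theorem le_smul (hs : s ≠ 0) {c : Lam κ Γ} (x : F) {g : Γ} (hg : c.coeff g ≠ 0) :
    p x - ((s * g : ℝ) : EReal) ≤ p (c • x) := by
  by_cases hx : x = 0
  · simp [hx, hp.map_zero]
  obtain ⟨r, hr⟩ := hp.exists_coe_eq hx
  rw [← hp.single_smul g hg x, sum_single_smul c x]
  refine hp.le_sum_of_injOn _ (fun g => (AddMonoidAlgebra.single g (c.coeff g) : Lam κ Γ) • x)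
    (fun g hg g' hg' h => ?_) (Finsupp.mem_support_iff.mpr hg)
  simp only at h
  rw [hp.single_smul g (Finsupp.mem_support_iff.mp hg), hp.single_smul g'
    (Finsupp.mem_support_iff.mp hg'), hr, ← EReal.coe_sub, ← EReal.coe_sub, EReal.coe_eq_coe_iff,
    sub_right_inj] at h
  exact Subtype.ext (mul_left_cancel₀ hs h)

end IsWeightedNorm

end WeightedNorm

/-! ### Common orthogonal bases for two norms of opposite weights. -/

section DoublyOrthogonal

variable {κ : Type*} [Field κ] {Γ : AddSubgroup ℝ}

theorem exists_coeff_ne_zero {c : Lam κ Γ} (hc : c ≠ 0) : ∃ g, c.coeff g ≠ 0 := by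
  by_contra! h
  exact hc (AddMonoidAlgebra.coeff_injective (Finsupp.ext h))

theorem exists_functional_coeff_ne_zero {F : Type*} [AddCommGroup F] [Module (Lam κ Γ) F]
    [Module.Free (Lam κ Γ) F] {x : F} (hx : x ≠ 0) :
    ∃ (i : Module.Free.ChooseBasisIndex (Lam κ Γ) F) (g : Γ),
      ((Module.Free.chooseBasis (Lam κ Γ) F).coord i x).coeff g ≠ 0 := by
  obtain ⟨i, hi⟩ : ∃ i, (Module.Free.chooseBasis (Lam κ Γ) F).coord i x ≠ 0 := by
    by_contra! h
    exact hx ((Module.Free.chooseBasis (Lam κ Γ) F).forall_coord_eq_zero_iff.mp h)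
  exact ⟨i, exists_coeff_ne_zero hi⟩

namespace IsWeightedNorm

variable [DiscreteTopology Γ]
variable {F : Type*} [AddCommGroup F] [Module (Lam κ Γ) F] {s : ℝ} {p : F → EReal}

/-- A functional on the free quotient that does not kill `y` takes the same value on all lifts of
`y`, and so bounds their norms from below uniformly. As these norms meet finitely many cosets of Γ,
the infimum is attained. -/
theorem exists_minimal_lift (hp : IsWeightedNorm (κ := κ) (Γ := Γ) s p) (hs : s = 1 ∨ s = -1)
    [Module.Finite (Lam κ Γ) F] [Module.Free (Lam κ Γ) F] (L : Submodule (Lam κ Γ) F)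
    [Module.Free (Lam κ Γ) (F ⧸ L)] (y : F ⧸ L) :
    ∃ x, L.mkQ x = y ∧ ∀ x', L.mkQ x' = y → p x ≤ p x' := by
  by_cases hy : y = 0
  · exact ⟨0, by simp [hy], fun x' _ => by simp [hp.map_zero]⟩
  have hreal : ∀ x, L.mkQ x = y → ∃ r : ℝ, p x = r := fun x hx =>
    hp.exists_coe_eq fun h0 => hy (by rw [← hx, h0, _root_.map_zero])
  obtain ⟨i, g, hg⟩ := exists_functional_coeff_ne_zero (κ := κ) (Γ := Γ) hy
  obtain ⟨C, hC⟩ := hp.bounded (((Module.Free.chooseBasis (Lam κ Γ) (F ⧸ L)).coord i).comp L.mkQ)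
  obtain ⟨x0, hx0⟩ := L.mkQ_surjective y
  obtain ⟨r0, hr0⟩ := hreal x0 hx0
  obtain ⟨a, ⟨x, hx, hxa⟩, hmin⟩ := exists_isLeast_of_finite_mk Γ
    (S := {r : ℝ | ∃ x, L.mkQ x = y ∧ p x = r}) ⟨r0, x0, hx0, hr0⟩
    ⟨-(s * g) - C, by
      rintro r ⟨x, hx, hr⟩
      have := hC x g (by rw [LinearMap.comp_apply, hx]; exact hg)
      rwa [hr, EReal.coe_le_coe_iff] at this⟩
    ((hp.finite_mk_values hs).subset (Set.image_mono fun r ⟨x, _, hr⟩ => ⟨x, hr⟩))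
  refine ⟨x, hx, fun x' hx' => ?_⟩
  obtain ⟨r, hr⟩ := hreal x' hx'
  rw [hxa, hr, EReal.coe_le_coe_iff]
  exact hmin ⟨x', hx', hr⟩

/-- A weighted norm induces a weighted norm on a torsion-free quotient. -/
theorem exists_quotient (hp : IsWeightedNorm (κ := κ) (Γ := Γ) s p) (hs : s = 1 ∨ s = -1)
    [Module.Finite (Lam κ Γ) F] [Module.Free (Lam κ Γ) F] (L : Submodule (Lam κ Γ) F)
    [Module.Free (Lam κ Γ) (F ⧸ L)] :
    ∃ p' : F ⧸ L → EReal, IsWeightedNorm (κ := κ) (Γ := Γ) s p' ∧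
      (∀ x, p' (L.mkQ x) ≤ p x) ∧ ∀ y, ∃ x, L.mkQ x = y ∧ p x = p' y := by
  choose l hl hmin using hp.exists_minimal_lift hs L
  refine ⟨fun y => p (l y), ⟨?_, fun y => hp.ne_top _, fun y z => ?_, fun g c y => ?_, fun φ => ?_⟩,
    fun x => hmin _ x rfl, fun y => ⟨l y, hl y, rfl⟩⟩
  · exact le_bot_iff.mp ((hmin 0 0 (_root_.map_zero _)).trans hp.map_zero.le)
  · exact (hmin _ (l y + l z) (by rw [map_add, hl, hl])).trans (hp.add_le _ _)
  · exact (hmin _ (AddMonoidAlgebra.single g c • l y) (by rw [map_smul, hl])).trans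
      (hp.single_smul_le _ _ _)
  · obtain ⟨C, hC⟩ := hp.bounded (φ.comp L.mkQ)
    exact ⟨C, fun y g hg => hC (l y) g (by rw [LinearMap.comp_apply, hl]; exact hg)⟩

/-- The bounds of one coordinate functional by `p` and by `q` involve -g and +g; their sum is
independent of g, so p + q is bounded below. Its values meet finitely many cosets because those of
`p` and `q` do. -/
theorem exists_minimal_add {q : F → EReal} (hp : IsWeightedNorm (κ := κ) (Γ := Γ) 1 p)
    (hq : IsWeightedNorm (κ := κ) (Γ := Γ) (-1) q)
    [Module.Finite (Lam κ Γ) F] [Module.Free (Lam κ Γ) F] [Nontrivial F] :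
    ∃ (e : F) (a b : ℝ), e ≠ 0 ∧ p e = a ∧ q e = b ∧
      ∀ (x : F) (a' b' : ℝ), x ≠ 0 → p x = a' → q x = b' → a + b ≤ a' + b' := by
  let S : Set ℝ := {r | ∃ (x : F) (a b : ℝ), x ≠ 0 ∧ p x = a ∧ q x = b ∧ r = a + b}
  have hne : S.Nonempty := by
    obtain ⟨x, hx⟩ := exists_ne (0 : F)
    obtain ⟨a, ha⟩ := hp.exists_coe_eq hx
    obtain ⟨b, hb⟩ := hq.exists_coe_eq hx
    exact ⟨a + b, x, a, b, hx, ha, hb, rfl⟩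
  have hbdd : BddBelow S := by
    let v := Module.Free.chooseBasis (Lam κ Γ) F
    choose C hC using fun i => hp.bounded (v.coord i)
    choose C' hC' using fun i => hq.bounded (v.coord i)
    obtain ⟨M, hM⟩ := (Set.finite_range fun i => C i + C' i).bddAbove
    refine ⟨-M, ?_⟩
    rintro r ⟨x, a, b, hx, ha, hb, rfl⟩
    obtain ⟨i, g, hg⟩ := exists_functional_coeff_ne_zero (κ := κ) (Γ := Γ) hx
    have h1 := hC i x g hg
    have h2 := hC' i x g hg
    rw [ha, EReal.coe_le_coe_iff] at h1
    rw [hb, EReal.coe_le_coe_iff] at h2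
    have h3 : C i + C' i ≤ M := hM ⟨i, rfl⟩
    linarith
  have hfin : ((QuotientAddGroup.mk : ℝ → ℝ ⧸ Γ) '' S).Finite := by
    refine (Set.Finite.image2 (· + ·) (hp.finite_mk_values (Or.inl rfl))
      (hq.finite_mk_values (Or.inr rfl))).subset ?_
    rintro _ ⟨r, ⟨x, a, b, hx, ha, hb, rfl⟩, rfl⟩
    exact ⟨_, ⟨a, ⟨x, ha⟩, rfl⟩, _, ⟨b, ⟨x, hb⟩, rfl⟩, rfl⟩
  obtain ⟨r, ⟨e, a, b, he, ha, hb, rfl⟩, hmin⟩ := exists_isLeast_of_finite_mk Γ hne hbdd hfin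
  exact ⟨e, a, b, he, ha, hb, fun x a' b' hx ha' hb' => hmin ⟨x, a', b', hx, ha', hb', rfl⟩⟩

/-- A vector minimizing the sum of two norms of opposite weights spans a saturated submodule. -/
theorem isTorsionFree_quotient_of_minimal {q : F → EReal}
    (hp : IsWeightedNorm (κ := κ) (Γ := Γ) 1 p) (hq : IsWeightedNorm (κ := κ) (Γ := Γ) (-1) q)
    [Module.Free (Lam κ Γ) F] {e : F} {a b : ℝ} (he : e ≠ 0) (ha : p e = a) (hb : q e = b)
    (hmin : ∀ (x : F) (a' b' : ℝ), x ≠ 0 → p x = a' → q x = b' → a + b ≤ a' + b') :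
    Module.IsTorsionFree (Lam κ Γ) (F ⧸ Submodule.span (Lam κ Γ) {e}) := by
  refine Module.IsTorsionFree.of_smul_eq_zero fun c y hc0 => ?_
  by_cases hc : c = 0
  · exact Or.inl hc
  right
  obtain ⟨x, rfl⟩ := Submodule.mkQ_surjective _ y
  rw [← map_smul, Submodule.mkQ_apply, Submodule.Quotient.mk_eq_zero,
    Submodule.mem_span_singleton] at hc0
  obtain ⟨l, hl⟩ := hc0
  rw [Submodule.mkQ_apply, Submodule.Quotient.mk_eq_zero, Submodule.mem_span_singleton]
  -- Here c x = l e. With g = u c + v l a greatest common divisor of c and l, the vector y = u e + v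
  -- x satisfies e = (c/g) y and x = (l/g) y. It remains to see that c/g is a unit.
  obtain ⟨g, hg⟩ := (IsPrincipalIdealRing.principal (Ideal.span {c, l})).principal
  have hcm : c ∈ Ideal.span {c, l} := Ideal.subset_span (by simp)
  have hlm : l ∈ Ideal.span {c, l} := Ideal.subset_span (by simp)
  have hgm : g ∈ Ideal.span {c, l} := by rw [hg]; exact Submodule.mem_span_singleton_self g
  rw [hg] at hcm hlm
  obtain ⟨c', hc'⟩ := Submodule.mem_span_singleton.mp hcm
  obtain ⟨l', hl'⟩ := Submodule.mem_span_singleton.mp hlm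
  obtain ⟨u, v, huv⟩ := Ideal.mem_span_pair.mp hgm
  rw [smul_eq_mul] at hc' hl'
  have hg0 : g ≠ 0 := fun h => hc (by rw [← hc', h, mul_zero])
  set y := u • e + v • x with hy
  have hcy : c' • y = e := by
    have : g • (c' • y) = g • e := by
      rw [smul_smul, mul_comm, hc', hy, smul_add, smul_smul, smul_smul, mul_comm c v, mul_smul v c,
        ← hl, smul_smul, ← add_smul, mul_comm c u, huv]
    exact smul_right_injective F hg0 this
  have hxy : x = l' • y := by
    have : c • x = c • (l' • y) := by
      rw [← hl, smul_smul, ← hc', mul_comm, ← mul_assoc, mul_comm l' c', mul_assoc, hl',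
        mul_comm, mul_smul, hcy]
    exact smul_right_injective F hc this
  have hy0 : y ≠ 0 := fun h => he (by rw [← hcy, h, smul_zero])
  obtain ⟨a', ha'⟩ := hp.exists_coe_eq hy0
  obtain ⟨b', hb'⟩ := hq.exists_coe_eq hy0
  have hle := hmin y a' b' hy0 ha' hb'
  -- From e = c' y: p(y) - g1 ≤ p(e) and q(y) + g2 ≤ q(e). Adding these and using minimality of e
  -- gives g2 ≤ g1, and by symmetry the support of c' is a single point.
  have hsupp : ∀ g1 g2 : Γ, c'.coeff g1 ≠ 0 → c'.coeff g2 ≠ 0 → (g2 : ℝ) ≤ g1 := by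
    intro g1 g2 h1 h2
    have e1 := hp.le_smul one_ne_zero y h1
    have e2 := hq.le_smul (by norm_num) y h2
    rw [hcy, ha, ha', ← EReal.coe_sub, EReal.coe_le_coe_iff] at e1
    rw [hcy, hb, hb', ← EReal.coe_sub, EReal.coe_le_coe_iff] at e2
    linarith
  have hc'0 : c' ≠ 0 := fun h => he (by rw [← hcy, h, zero_smul])
  obtain ⟨g0, hg0'⟩ := exists_coeff_ne_zero hc'0
  have hmono : c' = AddMonoidAlgebra.single g0 (c'.coeff g0) := by
    apply AddMonoidAlgebra.coeff_injective
    ext g1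
    rw [AddMonoidAlgebra.coeff_single]
    by_cases h : g1 = g0
    · subst h; simp
    · rw [Finsupp.single_eq_of_ne h]
      by_contra hne
      exact h (Subtype.ext (le_antisymm (hsupp _ _ hg0' hne) (hsupp _ _ hne hg0')))
  refine ⟨l' * AddMonoidAlgebra.single (-g0) (c'.coeff g0)⁻¹, ?_⟩
  rw [mul_smul, ← hcy, smul_smul _ c', hmono, AddMonoidAlgebra.single_mul_single]
  simp only [AddMonoidAlgebra.coeff_single, Finsupp.single_eq_same]
  rw [neg_add_cancel, inv_mul_cancel₀ hg0', ← AddMonoidAlgebra.one_def, one_smul, hxy]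

omit [DiscreteTopology Γ] in
/-- Adjoining a vector to a lift of an orthogonal family of the quotient. -/
theorem isWeightedOrthogonal_cons (hp : IsWeightedNorm (κ := κ) (Γ := Γ) s p) (hs : s ≠ 0)
    [Module.Free (Lam κ Γ) F] {e : F} {p' : F ⧸ Submodule.span (Lam κ Γ) {e} → EReal}
    (hp' : ∀ x, p' (Submodule.mkQ _ x) ≤ p x) {d : ℕ}
    {f : Fin d → F} (hf : ∀ i, p (f i) ≤ p' (Submodule.mkQ _ (f i)))
    (horth : IsWeightedOrthogonal (κ := κ) (Γ := Γ) s p' fun i => Submodule.mkQ _ (f i)) :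
    IsWeightedOrthogonal (κ := κ) (Γ := Γ) s p (Fin.cons e f : Fin (d + 1) → F) := by
  intro c
  have hmk : ∀ x : F, Submodule.mkQ (Submodule.span (Lam κ Γ) {e}) (c 0 • e + x) =
      Submodule.mkQ _ x := by
    intro x
    rw [map_add, map_smul, add_eq_right, Submodule.mkQ_apply,
      (Submodule.Quotient.mk_eq_zero _).mpr (Submodule.mem_span_singleton_self e), smul_zero]
  have hsum : ∑ j, c j • (Fin.cons e f : Fin (d + 1) → F) j =
      c 0 • e + ∑ j : Fin d, c j.succ • f j := by
    rw [Fin.sum_univ_succ]; simp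
  rw [hsum]
  -- The coefficients of the lifted vectors are controlled in the quotient, where the multiple of
  -- `e` disappears.
  have htail : ∀ (i : Fin d) (g : Γ), (c i.succ).coeff g ≠ 0 →
      p (f i) - ((s * g : ℝ) : EReal) ≤ p (c 0 • e + ∑ j : Fin d, c j.succ • f j) := by
    intro i g hg
    refine (EReal.sub_le_sub (hf i) le_rfl).trans ?_
    refine (horth (fun j => c j.succ) i g hg).trans ?_
    refine le_trans (le_of_eq ?_) (hp' _)
    rw [hmk, map_sum]
    simp only [map_smul]
  intro i g hg
  refine Fin.cases (fun hg => ?_) (fun i hg => ?_) i hg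
  · rw [Fin.cons_zero]
    refine (hp.le_smul hs e hg).trans ?_
    -- The multiple of `e` is the whole sum minus the tail, and the tail is bounded by the whole sum
    -- thanks to `htail`.
    have h1 := hp.sub_le (c 0 • e + ∑ j : Fin d, c j.succ • f j) (∑ j : Fin d, c j.succ • f j)
    rw [add_sub_cancel_right] at h1
    exact h1.trans (max_le le_rfl (hp.sum_le _ _ fun j _ => hp.smul_le fun g hg => htail j g hg))
  · rw [Fin.cons_succ]
    exact htail i g hg

omit [DiscreteTopology Γ] in
/-- If `e` minimizes the sum of two norms of opposite weights, then vectors of the quotient by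
`e` lift optimally for both norms at once. -/
theorem exists_common_lift {q : F → EReal}
    (hp : IsWeightedNorm (κ := κ) (Γ := Γ) 1 p) (hq : IsWeightedNorm (κ := κ) (Γ := Γ) (-1) q)
    [Module.Free (Lam κ Γ) F] {e : F} {a b : ℝ} (ha : p e = a) (hb : q e = b)
    (hmin : ∀ (x : F) (a' b' : ℝ), x ≠ 0 → p x = a' → q x = b' → a + b ≤ a' + b') {x1 x2 : F}
    (h12 : Submodule.mkQ (Submodule.span (Lam κ Γ) {e}) x1 = Submodule.mkQ _ x2) :
    ∃ x, Submodule.mkQ (Submodule.span (Lam κ Γ) {e}) x = Submodule.mkQ _ x1 ∧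
      p x ≤ p x1 ∧ q x ≤ q x2 := by
  classical
  have hmem : x2 - x1 ∈ Submodule.span (Lam κ Γ) {e} := by
    rw [← Submodule.Quotient.mk_eq_zero, Submodule.Quotient.mk_sub]
    exact sub_eq_zero.mpr h12.symm
  have hmk : ∀ (x : F) (c : Lam κ Γ),
      Submodule.mkQ (Submodule.span (Lam κ Γ) {e}) (x + c • e) = Submodule.mkQ _ x := by
    intro x c
    rw [map_add, map_smul, add_eq_left, Submodule.mkQ_apply,
      (Submodule.Quotient.mk_eq_zero _).mpr (Submodule.mem_span_singleton_self e), smul_zero]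
  obtain ⟨l, hl⟩ := Submodule.mem_span_singleton.mp hmem
  by_cases hx1 : x1 = 0
  · refine ⟨0, by simp [hx1], by simp [hp.map_zero], by simp [hq.map_zero]⟩
  obtain ⟨r, hr⟩ := hp.exists_coe_eq hx1
  -- The threshold: p(T^g e) = a - g is at most r = p(x1) exactly when g ≥ a - r. Adding these terms
  -- of `l` to `x1` does not raise `p`; the remaining ones are to be harmless for `q`.
  let hi : Lam κ Γ := AddMonoidAlgebra.ofCoeff (l.coeff.filter fun g : Γ => a - r ≤ (g : ℝ))
  let lo : Lam κ Γ := AddMonoidAlgebra.ofCoeff (l.coeff.filter fun g : Γ => ¬ a - r ≤ (g : ℝ))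
  have hsplit : hi + lo = l :=
    AddMonoidAlgebra.coeff_injective (Finsupp.filter_add_filter_not _ _)
  have hpx : p (x1 + hi • e) ≤ p x1 := by
    refine (hp.add_le _ _).trans (max_le le_rfl (hp.smul_le fun g hg => ?_))
    have : a - r ≤ (g : ℝ) := by
      by_contra h
      exact hg (Finsupp.filter_apply_neg (fun g : Γ => a - r ≤ (g : ℝ)) l.coeff h)
    rw [ha, hr, ← EReal.coe_sub, EReal.coe_le_coe_iff]
    linarith
  refine ⟨x1 + hi • e, hmk _ _, hpx, ?_⟩
  by_cases hx : x1 + hi • e = 0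
  · rw [hx, hq.map_zero]; exact bot_le
  obtain ⟨r1, hr1⟩ := hp.exists_coe_eq hx
  obtain ⟨r2, hr2⟩ := hq.exists_coe_eq hx
  have hm := hmin _ _ _ hx hr1 hr2
  rw [hr1, hr, EReal.coe_le_coe_iff] at hpx
  have hx' : x1 + hi • e = x2 - lo • e := by
    have : x2 = x1 + (hi + lo) • e := by rw [hsplit, hl]; abel
    rw [this, add_smul]; abel
  by_contra! hlt
  have h2 := hq.sub_le x2 (lo • e)
  rw [← hx'] at h2
  -- By minimality of `e`, the new vector has q at least a + b - r, whereas q(T^g e) = b + g is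
  -- smaller than that for g < a - r.
  have h3 : q (lo • e) < q (x1 + hi • e) := by
    rw [sum_single_smul, hr2]
    refine hq.sum_lt _ _ (EReal.bot_lt_coe _) fun g hg => ?_
    refine (hq.single_smul_le _ _ _).trans_lt ?_
    have : ¬ a - r ≤ (g : ℝ) := by
      intro h
      exact (Finsupp.mem_support_iff.mp hg)
        (Finsupp.filter_apply_neg (fun g : Γ => ¬ a - r ≤ (g : ℝ)) l.coeff (not_not.mpr h))
    rw [hb, ← EReal.coe_sub, EReal.coe_lt_coe_iff]
    linarith
  exact absurd h2 (not_le.mpr (max_lt hlt h3))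

/-- Two weighted norms of opposite weights on a finitely generated torsion-free module have a
common orthogonal basis. -/
theorem exists_common_orthogonal (m : ℕ) : ∀ {F : Type*} [AddCommGroup F] [Module (Lam κ Γ) F]
    [Module.Finite (Lam κ Γ) F] [Module.Free (Lam κ Γ) F] {p q : F → EReal},
    IsWeightedNorm (κ := κ) (Γ := Γ) 1 p → IsWeightedNorm (κ := κ) (Γ := Γ) (-1) q →
    Module.finrank (Lam κ Γ) F = m →
    ∃ (d : ℕ) (e : Fin d → F), (∀ i, e i ≠ 0) ∧
      Submodule.span (Lam κ Γ) (Set.range e) = ⊤ ∧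
      IsWeightedOrthogonal (κ := κ) (Γ := Γ) 1 p e ∧
      IsWeightedOrthogonal (κ := κ) (Γ := Γ) (-1) q e := by
  induction m using Nat.strong_induction_on with
  | _ m ih =>
  intro F _ _ _ _ p q hp hq hm
  rcases subsingleton_or_nontrivial F with hF | hF
  · exact ⟨0, Fin.elim0, fun i => i.elim0, Subsingleton.elim _ _, fun c i => i.elim0, fun c i => i.elim0⟩
  obtain ⟨e, a, b, he, ha, hb, hmin⟩ := hp.exists_minimal_add hq
  set L := Submodule.span (Lam κ Γ) {e} with hL
  have htf : Module.IsTorsionFree (Lam κ Γ) (F ⧸ L) :=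
    hp.isTorsionFree_quotient_of_minimal hq he ha hb hmin
  have hfree : Module.Free (Lam κ Γ) (F ⧸ L) := inferInstance
  obtain ⟨p', hp', hpp', hpl⟩ := hp.exists_quotient (Or.inl rfl) L
  obtain ⟨q', hq', hqq', hql⟩ := hq.exists_quotient (Or.inr rfl) L
  have hrank : Module.finrank (Lam κ Γ) (F ⧸ L) < m := by
    have h1 := Submodule.finrank_quotient_add_finrank L
    have h2 : 1 ≤ Module.finrank (Lam κ Γ) L := by
      rw [Submodule.one_le_finrank_iff, hL, Ne, Submodule.span_singleton_eq_bot]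
      exact he
    omega
  obtain ⟨d, f', hne, hspan, hfp, hfq⟩ := ih _ hrank hp' hq' rfl
  have hlift : ∀ i, ∃ x, L.mkQ x = f' i ∧ p x ≤ p' (f' i) ∧ q x ≤ q' (f' i) := by
    intro i
    obtain ⟨x1, h1, h1'⟩ := hpl (f' i)
    obtain ⟨x2, h2, h2'⟩ := hql (f' i)
    obtain ⟨x, hx, hx1, hx2⟩ := hp.exists_common_lift hq ha hb hmin (h1.trans h2.symm)
    exact ⟨x, hx.trans h1, h1' ▸ hx1, h2' ▸ hx2⟩
  choose f hf hfp' hfq' using hlift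
  have hff : (fun i => L.mkQ (f i)) = f' := funext hf
  refine ⟨d + 1, Fin.cons e f, ?_, ?_, ?_, ?_⟩
  · intro i
    refine Fin.cases ?_ (fun i => ?_) i
    · rwa [Fin.cons_zero]
    · rw [Fin.cons_succ]
      intro h0
      exact hne i (by rw [← hf, h0, _root_.map_zero])
  · rw [Fin.range_cons, Submodule.span_insert, ← hL]
    rw [← hff] at hspan
    have : (Submodule.span (Lam κ Γ) (Set.range f)).map L.mkQ = ⊤ := by
      rw [Submodule.map_span, ← Set.range_comp]; exact hspan
    have h2 := congrArg (Submodule.comap L.mkQ) this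
    rwa [Submodule.comap_map_mkQ, Submodule.comap_top] at h2
  · exact hp.isWeightedOrthogonal_cons one_ne_zero hpp' (fun i => (hfp' i).trans (by rw [hf]))
      (by rw [hff]; exact hfp)
  · exact hq.isWeightedOrthogonal_cons (by norm_num) hqq' (fun i => (hfq' i).trans (by rw [hf]))
      (by rw [hff]; exact hfq)

end IsWeightedNorm

end DoublyOrthogonal

/-! ### The Novikov field -/

section NovikovField

variable {κ : Type*} [Field κ] {Γ : AddSubgroup ℝ}

namespace LamUp

theorem ext {x y : LamUp κ Γ} (h : ∀ g, x.coeff g = y.coeff g) : x = y :=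
  Subtype.ext (HahnSeries.ext (funext h))

theorem coeff_zero (g : Γ) : (0 : LamUp κ Γ).coeff g = 0 := rfl

theorem coeff_add (x y : LamUp κ Γ) (g : Γ) : (x + y).coeff g = x.coeff g + y.coeff g := rfl

theorem coeff_neg (x : LamUp κ Γ) (g : Γ) : (-x).coeff g = -x.coeff g := rfl

theorem coeff_sub (x y : LamUp κ Γ) (g : Γ) : (x - y).coeff g = x.coeff g - y.coeff g := by
  rw [sub_eq_add_neg, coeff_add, coeff_neg, sub_eq_add_neg]

theorem exists_coeff_sum_ne_zero {ι : Type*} (T : Finset ι) (x : ι → LamUp κ Γ) (g : Γ)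
    (h : (∑ i ∈ T, x i).coeff g ≠ 0) : ∃ i ∈ T, (x i).coeff g ≠ 0 := by
  classical
  induction T using Finset.induction_on with
  | empty => exact absurd rfl h
  | insert a T ha ih =>
    rw [Finset.sum_insert ha, coeff_add] at h
    by_cases h1 : (x a).coeff g = 0
    · rw [h1, zero_add] at h
      obtain ⟨i, hi, hi'⟩ := ih h
      exact ⟨i, Finset.mem_insert_of_mem hi, hi'⟩
    · exact ⟨a, Finset.mem_insert_self _ _, h1⟩

theorem exists_of_coeff_mul_ne_zero (x y : LamUp κ Γ) (g : Γ) (h : (x * y).coeff g ≠ 0) :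
    ∃ g1 g2, x.coeff g1 ≠ 0 ∧ y.coeff g2 ≠ 0 ∧ g1 + g2 = g := by
  have hg' : g ∈ (x.1 * y.1).support := h
  obtain ⟨a, ha, b, hb, hab⟩ := HahnSeries.support_mul_subset hg'
  exact ⟨a, b, ha, hb, hab⟩

theorem nuUp_le {x : LamUp κ Γ} {g : Γ} (hg : x.coeff g ≠ 0) : nuUp x ≤ ((g : ℝ) : EReal) :=
  iInf₂_le g hg

theorem coeff_order_ne_zero {x : LamUp κ Γ} (hx : x ≠ 0) : x.coeff x.1.order ≠ 0 := by
  have h : x.1.coeff x.1.order ≠ 0 := by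
    rw [Ne, HahnSeries.coeff_order_eq_zero]
    exact fun h => hx (Subtype.ext h)
  exact h

theorem nuUp_eq_order {x : LamUp κ Γ} (hx : x ≠ 0) : nuUp x = ((x.1.order : ℝ) : EReal) :=
  le_antisymm (nuUp_le (coeff_order_ne_zero hx)) (le_iInf₂ fun _ hg =>
    EReal.coe_le_coe_iff.mpr (HahnSeries.order_le_of_coeff_ne_zero (x := x.1) hg))

theorem exists_coeff_ne_zero_nuUp_eq {x : LamUp κ Γ} (hx : x ≠ 0) :
    ∃ g : Γ, x.coeff g ≠ 0 ∧ nuUp x = ((g : ℝ) : EReal) :=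
  ⟨_, coeff_order_ne_zero hx, nuUp_eq_order hx⟩

theorem nuUp_zero : nuUp (0 : LamUp κ Γ) = ⊤ := by
  simp [nuUp, coeff_zero]

theorem exists_lower_bound (x : LamUp κ Γ) : ∃ m : ℝ, ∀ g : Γ, x.coeff g ≠ 0 → m ≤ g := by
  by_cases hx : x = 0
  · exact ⟨0, fun g hg => absurd (by rw [hx]; rfl) hg⟩
  · obtain ⟨g, -, hg⟩ := exists_coeff_ne_zero_nuUp_eq hx
    exact ⟨g, fun g' hg' => EReal.coe_le_coe_iff.mp (hg ▸ nuUp_le hg')⟩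

theorem nuUp_add_le_nuUp_mul (x y : LamUp κ Γ) : nuUp x + nuUp y ≤ nuUp (x * y) := by
  refine le_iInf₂ fun g hg => ?_
  obtain ⟨g1, g2, h1, h2, rfl⟩ := exists_of_coeff_mul_ne_zero x y g hg
  refine (add_le_add (nuUp_le h1) (nuUp_le h2)).trans (le_of_eq ?_)
  rw [← EReal.coe_add]; rfl

theorem nuUp_mul_le {x y : LamUp κ Γ} (hx : x ≠ 0) (hy : y ≠ 0) :
    nuUp (x * y) ≤ nuUp x + nuUp y := by
  have hx' : x.1 ≠ 0 := fun h => hx (Subtype.ext h)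
  have hy' : y.1 ≠ 0 := fun h => hy (Subtype.ext h)
  rw [nuUp_eq_order hx, nuUp_eq_order hy, ← EReal.coe_add, ← AddSubgroup.coe_add]
  refine nuUp_le (x := x * y) ?_
  change (x.1 * y.1).coeff _ ≠ 0
  rw [HahnSeries.coeff_mul_order_add_order]
  exact mul_ne_zero (HahnSeries.leadingCoeff_ne_zero.mpr hx')
    (HahnSeries.leadingCoeff_ne_zero.mpr hy')

theorem zero_le_nuUp_one : ((0 : ℝ) : EReal) ≤ nuUp (1 : LamUp κ Γ) := by
  refine le_iInf₂ fun g hg => ?_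
  have : g = 0 := by
    by_contra h
    refine hg ?_
    change (1 : HahnSeries Γ κ).coeff g = 0
    rw [HahnSeries.coeff_one, if_neg h]
  rw [this]; simp

theorem nuUp_neg (x : LamUp κ Γ) : nuUp (-x) = nuUp x := by
  simp only [nuUp, coeff_neg, ne_eq, neg_eq_zero]

theorem min_le_nuUp_add (x y : LamUp κ Γ) : min (nuUp x) (nuUp y) ≤ nuUp (x + y) := by
  refine le_iInf₂ fun g hg => ?_
  by_cases h : x.coeff g = 0
  · have : y.coeff g ≠ 0 := by rwa [coeff_add, h, zero_add] at hg
    exact (min_le_right _ _).trans (nuUp_le this)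
  · exact (min_le_left _ _).trans (nuUp_le h)

theorem incUp_coeff (x : Lam κ Γ) (g : Γ) : (incUp κ Γ x).coeff g = x.coeff g := by
  induction x using AddMonoidAlgebra.induction_linear with
  | zero => rw [map_zero]; rfl
  | add x y hx hy => rw [map_add, coeff_add, hx, hy]; rfl
  | single a r =>
    have : (incUp κ Γ (AddMonoidAlgebra.single a r)).1 = HahnSeries.single a r :=
      toNovikov_single κ _ _ a r
    change (incUp κ Γ (AddMonoidAlgebra.single a r)).1.coeff g = _
    rw [this, AddMonoidAlgebra.coeff_single]
    by_cases h : g = a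
    · subst h; simp
    · rw [HahnSeries.coeff_single_of_ne h, Finsupp.single_eq_of_ne h]

theorem incUp_injective : Function.Injective (incUp κ Γ) := fun x y h =>
  AddMonoidAlgebra.coeff_injective (Finsupp.ext fun g => by
    rw [← incUp_coeff, ← incUp_coeff, h])

/-- Truncation to an element of the group algebra. -/
theorem exists_truncation (x : LamUp κ Γ) (T : ℝ) :
    ∃ y : Lam κ Γ, ∀ g : Γ, y.coeff g = if (g : ℝ) < T then x.coeff g else 0 := by
  classical
  refine ⟨AddMonoidAlgebra.ofCoeff (Finsupp.ofSupportFinite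
    (fun g : Γ => if (g : ℝ) < T then x.coeff g else 0) ?_), fun g => rfl⟩
  refine (x.2 T).subset fun g hg => ?_
  have hg' : (if (g : ℝ) < T then x.coeff g else 0) ≠ 0 := hg
  split_ifs at hg' with h
  · exact ⟨hg', h⟩
  · exact absurd rfl hg'

variable [DiscreteTopology Γ]

theorem mem_of_lower_bound (x : HahnSeries Γ κ) (m : ℝ) (hm : ∀ g, x.coeff g ≠ 0 → m ≤ (g : ℝ)) :
    x ∈ novikovSubalgebra κ (weightUp Γ) (weightUp_mono Γ) := fun C =>
  (finite_setOf_mem_Icc Γ m C).subset fun g hg => ⟨hm g hg.1, le_of_lt hg.2⟩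

/-- For discrete Γ the finiteness condition holds for all Hahn series, so Λ_↑ is closed under their
inversion and is a field. -/
theorem mem_novikovSubalgebra (x : HahnSeries Γ κ) :
    x ∈ novikovSubalgebra κ (weightUp Γ) (weightUp_mono Γ) :=
  mem_of_lower_bound x x.order fun _ hg =>
    Subtype.coe_le_coe.mpr (HahnSeries.order_le_of_coeff_ne_zero hg)

/-- This produces the coefficientwise limits in the completeness argument of
`exists_dist_lower_bound`. -/
theorem exists_of_lower_bound (f : Γ → κ) (m : ℝ) (hf : ∀ g, f g ≠ 0 → m ≤ (g : ℝ)) :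
    ∃ x : LamUp κ Γ, ∀ g, x.coeff g = f g := by
  have hfin : ∀ C : ℝ, {g : Γ | f g ≠ 0 ∧ (g : ℝ) ≤ C}.Finite := fun C =>
    (finite_setOf_mem_Icc Γ m C).subset fun g hg => ⟨hf g hg.1, hg.2⟩
  have hwf : (Function.support f).IsWF := by
    rw [Set.isWF_iff_no_descending_seq]
    intro u hu hmem
    refine Set.infinite_range_of_injective hu.injective ((hfin (u 0)).subset ?_)
    rintro _ ⟨n, rfl⟩
    exact ⟨hmem n, Subtype.coe_le_coe.mpr (hu.antitone (Nat.zero_le n))⟩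
  exact ⟨⟨⟨f, hwf.isPWO⟩, mem_of_lower_bound _ m hf⟩, fun g => rfl⟩

instance : Field (LamUp κ Γ) :=
  { (inferInstance : CommRing (LamUp κ Γ)) with
    inv := fun x => ⟨x.1⁻¹, mem_novikovSubalgebra _⟩
    exists_pair_ne := ⟨0, 1, fun h => zero_ne_one (congrArg Subtype.val h)⟩
    mul_inv_cancel := fun x hx => Subtype.ext (mul_inv_cancel₀ fun h => hx (Subtype.ext h))
    inv_zero := Subtype.ext inv_zero
    nnqsmul := _
    nnqsmul_def := fun _ _ => rfl
    qsmul := _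
    qsmul_def := fun _ _ => rfl }

end LamUp

end NovikovField

/-! ### Filtered vector spaces over the Novikov field -/

section Filtered

variable {κ : Type*} [Field κ] {Γ : AddSubgroup ℝ}
variable {V : Type*} [AddCommGroup V] [Module (LamUp κ Γ) V] {ρ : V → EReal}

namespace IsNormUp

variable (hρ : IsNormUp κ Γ ρ)
include hρ

theorem exists_coe_eq {x : V} (hx : x ≠ 0) : ∃ r : ℝ, ρ x = r :=
  ⟨(ρ x).toReal, (EReal.coe_toReal (hρ.ne_top x) fun h => hx ((hρ.eq_bot_iff x).mp h)).symm⟩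

theorem map_zero : ρ 0 = ⊥ := (hρ.eq_bot_iff 0).mpr rfl

theorem map_neg_le (x : V) : ρ (-x) ≤ ρ x := by
  rw [← neg_one_smul (LamUp κ Γ) x, hρ.smul]
  have h1 := LamUp.zero_le_nuUp_one (κ := κ) (Γ := Γ)
  rw [← LamUp.nuUp_neg] at h1
  refine (EReal.sub_le_sub le_rfl h1).trans ?_
  simp

theorem sub_le (x y : V) : ρ (x - y) ≤ max (ρ x) (ρ y) := by
  rw [sub_eq_add_neg]
  exact (hρ.add_le _ _).trans (max_le_max le_rfl (hρ.map_neg_le y))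

theorem sum_le {ι : Type*} (T : Finset ι) (y : ι → V) {B : EReal} (h : ∀ t ∈ T, ρ (y t) ≤ B) :
    ρ (∑ t ∈ T, y t) ≤ B := by
  classical
  induction T using Finset.induction_on with
  | empty => simp [hρ.map_zero]
  | insert a T ha ih =>
    rw [Finset.sum_insert ha]
    exact (hρ.add_le _ _).trans (max_le (h _ (Finset.mem_insert_self _ _))
      (ih fun t ht => h t (Finset.mem_insert_of_mem ht)))

theorem exists_upper_bound {d : ℕ} (v : Fin d → V) : ∃ K : ℝ, ∀ i, ρ (v i) ≤ K := by
  obtain ⟨K, hK⟩ := (Set.finite_range fun i => (ρ (v i)).toReal).bddAbove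
  refine ⟨K, fun i => ?_⟩
  by_cases hi : v i = 0
  · rw [hi, hρ.map_zero]; exact bot_le
  · obtain ⟨r, hr⟩ := hρ.exists_coe_eq hi
    have : (ρ (v i)).toReal ≤ K := hK ⟨i, rfl⟩
    rw [hr, EReal.toReal_coe] at this
    rw [hr]; exact EReal.coe_le_coe_iff.mpr this

theorem sum_smul_le {d : ℕ} {v : Fin d → V} {K T : ℝ} (hK : ∀ i, ρ (v i) ≤ K)
    (c : Fin d → LamUp κ Γ) (hc : ∀ i g, (c i).coeff g ≠ 0 → T ≤ (g : ℝ)) :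
    ρ (∑ i, c i • v i) ≤ ((K - T : ℝ) : EReal) := by
  refine hρ.sum_le _ _ fun i _ => ?_
  rw [hρ.smul, EReal.coe_sub]
  exact EReal.sub_le_sub (hK i) (le_iInf₂ fun g hg => EReal.coe_le_coe_iff.mpr (hc i g hg))

/-- Orthogonality over the group algebra extends to the Novikov field. -/
theorem eq_iSup_of_orthogonal {d : ℕ} {v : Fin d → V}
    (h : ∀ (c : Fin d → Lam κ Γ) (i : Fin d) (g : Γ), (c i).coeff g ≠ 0 →
      ρ (v i) - ((g : ℝ) : EReal) ≤ ρ (∑ j, incUp κ Γ (c j) • v j)) (c : Fin d → LamUp κ Γ) :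
    ρ (∑ i, c i • v i) = ⨆ i, (ρ (v i) - nuUp (c i)) := by
  refine le_antisymm (hρ.sum_le _ _ fun i _ => ?_) (iSup_le fun i => ?_)
  · rw [hρ.smul]
    exact le_iSup (fun i => ρ (v i) - nuUp (c i)) i
  by_cases hc : c i = 0
  · rw [← hρ.smul, hc, zero_smul, hρ.map_zero]; exact bot_le
  by_cases hv : v i = 0
  · rw [← hρ.smul, hv, smul_zero, hρ.map_zero]; exact bot_le
  obtain ⟨g0, hg0, hnu⟩ := LamUp.exists_coeff_ne_zero_nuUp_eq hc
  obtain ⟨a, ha⟩ := hρ.exists_coe_eq hv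
  obtain ⟨K, hK⟩ := hρ.exists_upper_bound v
  -- The first bound keeps the exponent g0 in the truncation; the second makes the truncation error,
  -- at most K - T, smaller than the term a - g0 to be estimated.
  set T : ℝ := max (g0 + 1) (K - a + g0 + 1) with hT
  have hT1 : (g0 : ℝ) + 1 ≤ T := le_max_left _ _
  have hT2 : K - a + g0 + 1 ≤ T := le_max_right _ _
  choose c' hc' using fun j => LamUp.exists_truncation (c j) T
  have h1 := h c' i g0 (by rw [hc', if_pos (by linarith)]; exact hg0)
  have h2 : ρ (∑ j, (c j - incUp κ Γ (c' j)) • v j) ≤ ((K - T : ℝ) : EReal) := by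
    refine hρ.sum_smul_le hK _ fun j g hg => ?_
    by_contra! hlt
    refine hg ?_
    rw [LamUp.coeff_sub, LamUp.incUp_coeff, hc', if_pos hlt, sub_self]
  have h3 := hρ.sub_le (∑ j, c j • v j) (∑ j, (c j - incUp κ Γ (c' j)) • v j)
  have h4 : ∑ j, c j • v j - ∑ j, (c j - incUp κ Γ (c' j)) • v j =
      ∑ j, incUp κ Γ (c' j) • v j := by
    rw [← Finset.sum_sub_distrib]
    exact Finset.sum_congr rfl fun j _ => by rw [sub_smul]; abel
  rw [h4] at h3
  rw [hnu]
  rcases le_max_iff.mp (h1.trans h3) with h5 | h5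
  · exact h5
  · have := h5.trans h2
    rw [ha, ← EReal.coe_sub, EReal.coe_le_coe_iff] at this
    linarith

theorem dualNorm_eq_top_iff (ζ : NovDual κ Γ V) : dualNorm ρ ζ = ⊤ ↔ ζ = 0 := by
  constructor
  · intro h
    refine DFunLike.ext _ _ fun x => ?_
    by_contra hx
    have hx' : ζ x ≠ 0 := hx
    have hx0 : x ≠ 0 := fun h0 => hx' (by rw [h0]; exact LinearMap.map_zero (show Module.Dual _ _ from ζ))
    obtain ⟨g, -, hg⟩ := LamUp.exists_coeff_ne_zero_nuUp_eq hx'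
    obtain ⟨r, hr⟩ := hρ.exists_coe_eq hx0
    have : dualNorm ρ ζ ≤ nuUp (ζ x) + ρ x := iInf₂_le x hx0
    rw [h, hg, hr, ← EReal.coe_add] at this
    exact EReal.coe_ne_top _ (top_le_iff.mp this)
  · rintro rfl
    refine top_le_iff.mp (le_iInf₂ fun x hx => ?_)
    obtain ⟨r, hr⟩ := hρ.exists_coe_eq hx
    have : nuUp ((0 : NovDual κ Γ V) x) = ⊤ := LamUp.nuUp_zero
    rw [this, hr]; simp

-- One inequality is enough: applied to `c⁻¹` it becomes the reverse one, as used in `neg_dualNorm`.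
omit hρ in
theorem add_dualNorm_le (c : LamUp κ Γ) (ζ : Module.Dual (LamUp κ Γ) V) :
    nuUp c + dualNorm ρ (ζ : NovDual κ Γ V) ≤ dualNorm ρ (c • ζ : Module.Dual (LamUp κ Γ) V) := by
  refine le_iInf₂ fun x hx => ?_
  have h1 : dualNorm ρ (ζ : NovDual κ Γ V) ≤ nuUp (ζ x) + ρ x := iInf₂_le x hx
  have h2 := LamUp.nuUp_add_le_nuUp_mul c (ζ x)
  refine (add_le_add le_rfl h1).trans ?_
  rw [← add_assoc]
  exact add_le_add h2 le_rfl

variable [DiscreteTopology Γ]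

/-- The span of `v` is complete, so a vector outside it has a distance from it. If sums v0 + ∑ c_R v
had norms below every R, then by `hC` the coefficients of c_R would stabilize as R → -∞, and the
limit coefficients would give a vector of norm `⊥`. -/
theorem exists_dist_lower_bound {d : ℕ} (v0 : V) (v : Fin d → V) {C : ℝ}
    (hC : ∀ (c : Fin d → LamUp κ Γ) (i : Fin d) (g : Γ), (c i).coeff g ≠ 0 →
      ((-g - C : ℝ) : EReal) ≤ ρ (∑ j, c j • v j))
    (hv0 : ∀ c : Fin d → LamUp κ Γ, v0 + ∑ j, c j • v j ≠ 0) :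
    ∃ R : ℝ, ∀ c : Fin d → LamUp κ Γ, (R : EReal) ≤ ρ (v0 + ∑ j, c j • v j) := by
  by_contra! hR
  choose c hc using hR
  have hagree : ∀ (R R' : ℝ), R ≤ R' → ∀ (i : Fin d) (g : Γ), (g : ℝ) < -R' - C →
      (c R i).coeff g = (c R' i).coeff g := by
    intro R R' hRR i g hg
    by_contra hne
    have h1 := hC (fun j => c R j - c R' j) i g (by
      rw [LamUp.coeff_sub]; exact sub_ne_zero.mpr hne)
    have h2 := hρ.sub_le (v0 + ∑ j, c R j • v j) (v0 + ∑ j, c R' j • v j)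
    rw [add_sub_add_left_eq_sub, ← Finset.sum_sub_distrib] at h2
    simp only [← sub_smul] at h2
    have h3 : max (ρ (v0 + ∑ j, c R j • v j)) (ρ (v0 + ∑ j, c R' j • v j)) ≤ R' :=
      max_le ((hc R).le.trans (EReal.coe_le_coe_iff.mpr hRR)) (hc R').le
    have h4 := EReal.coe_le_coe_iff.mp (h1.trans (h2.trans h3))
    linarith
  -- The coefficient at g is already stable at R = -g - C - 1, so the limit is read off there. For g
  -- ≤ -C - 1 this R is nonnegative and the coefficient agrees with that of `c 0`, which bounds the
  -- support of the limit from below.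
  have hlim : ∀ i : Fin d, ∃ x : LamUp κ Γ, ∀ g : Γ,
      x.coeff g = (c (-g - C - 1) i).coeff g := by
    intro i
    obtain ⟨m, hm⟩ := (c 0 i).exists_lower_bound
    refine LamUp.exists_of_lower_bound _ (min m (-C - 1)) fun g hg => ?_
    by_cases h : (g : ℝ) ≤ -C - 1
    · rw [← hagree 0 (-g - C - 1) (by linarith) i g (by linarith)] at hg
      exact (min_le_left _ _).trans (hm g hg)
    · exact (min_le_right _ _).trans (not_le.mp h).le
  choose l hl using hlim
  obtain ⟨K, hK⟩ := hρ.exists_upper_bound v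
  obtain ⟨r, hr⟩ := hρ.exists_coe_eq (hv0 l)
  have hbound : ∀ R : ℝ, r ≤ max R (K + R + C + 1) := by
    intro R
    have h1 : ρ (∑ j, (l j - c R j) • v j) ≤ ((K - (-R - C - 1) : ℝ) : EReal) := by
      refine hρ.sum_smul_le hK _ fun j g hg => ?_
      by_contra! hlt
      refine hg ?_
      rw [LamUp.coeff_sub, hl, sub_eq_zero]
      exact (hagree R (-g - C - 1) (by linarith) j g (by linarith)).symm
    have h2 := hρ.add_le (v0 + ∑ j, c R j • v j) (∑ j, (l j - c R j) • v j)
    have h3 : v0 + ∑ j, c R j • v j + ∑ j, (l j - c R j) • v j = v0 + ∑ j, l j • v j := by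
      simp only [sub_smul, Finset.sum_sub_distrib]; abel
    rw [h3, hr] at h2
    have h4 := h2.trans (max_le_max (hc R).le h1)
    rw [← EReal.coe_strictMono.monotone.map_max, EReal.coe_le_coe_iff] at h4
    refine h4.trans (le_of_eq ?_)
    congr 1; ring
  have h1 := hbound (min (r - 1) (r - 1 - K - C - 1))
  rcases le_max_iff.mp h1 with h | h
  · have := min_le_left (r - 1) (r - 1 - K - C - 1); linarith
  · have := min_le_right (r - 1) (r - 1 - K - C - 1); linarith

/-- The coordinates in a linearly independent family are bounded by the norm. -/
theorem exists_coordinate_bound : ∀ {d : ℕ} (v : Fin d → V), LinearIndependent (LamUp κ Γ) v →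
    ∃ C : ℝ, ∀ (c : Fin d → LamUp κ Γ) (i : Fin d) (g : Γ), (c i).coeff g ≠ 0 →
      ((-g - C : ℝ) : EReal) ≤ ρ (∑ j, c j • v j) := by
  intro d
  induction d with
  | zero => exact fun v _ => ⟨0, fun c i => i.elim0⟩
  | succ d ih =>
    intro v hv
    have hli : LinearIndependent (LamUp κ Γ) fun i : Fin d => v i.succ :=
      hv.comp _ (Fin.succ_injective d)
    obtain ⟨C, hC⟩ := ih _ hli
    obtain ⟨R, hR⟩ := hρ.exists_dist_lower_bound (v 0) (fun i : Fin d => v i.succ) hC (by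
      intro c h0
      have := Fintype.linearIndependent_iff.mp hv (Fin.cons 1 c) (by
        rw [Fin.sum_univ_succ]; simpa using h0) 0
      simp at this)
    obtain ⟨K, hK⟩ := hρ.exists_upper_bound v
    -- `D` is the possible gain in norm on passing from x to its tail: the head has norm at most K -
    -- ν(c 0), while x has norm at least R - ν(c 0).
    set D : ℝ := max 0 (K - R)
    refine ⟨max (-R) (C + D), fun c => ?_⟩
    rw [Fin.sum_univ_succ]
    set x := c 0 • v 0 + ∑ j : Fin d, c j.succ • v j.succ with hx
    have hhead : ∀ g : Γ, (c 0).coeff g ≠ 0 → ((-g + R : ℝ) : EReal) ≤ ρ x := by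
      intro g hg
      have hc0 : c 0 ≠ 0 := fun h => hg (by rw [h]; rfl)
      -- Dividing by c 0 reduces to a vector in v 0 plus the span of the others, where the distance
      -- bound `R` applies.
      have hx' : x = c 0 • (v 0 + ∑ j : Fin d, ((c 0)⁻¹ * c j.succ) • v j.succ) := by
        rw [smul_add, Finset.smul_sum]
        simp only [smul_smul, mul_inv_cancel_left₀ hc0]
        exact hx
      rw [hx', hρ.smul]
      refine le_trans (le_of_eq ?_) (EReal.sub_le_sub (hR _) (LamUp.nuUp_le hg))
      rw [← EReal.coe_sub]; congr 1; ring
    have htail : ρ (∑ j : Fin d, c j.succ • v j.succ) ≤ ρ x + (D : EReal) := by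
      have h1 := hρ.sub_le x (c 0 • v 0)
      rw [hx, add_sub_cancel_left, ← hx] at h1
      refine h1.trans (max_le ?_ ?_)
      · have : ρ x + 0 ≤ ρ x + (D : EReal) :=
          add_le_add le_rfl (EReal.coe_le_coe_iff.mpr (le_max_left 0 (K - R)))
        simpa using this
      · by_cases hc0 : c 0 = 0
        · rw [hc0, zero_smul, hρ.map_zero]; exact bot_le
        obtain ⟨g, hg, hnu⟩ := LamUp.exists_coeff_ne_zero_nuUp_eq hc0
        rw [hρ.smul, hnu]
        have h2 := add_le_add (hhead g hg) (EReal.coe_le_coe_iff.mpr (le_max_right 0 (K - R)))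
        refine le_trans (EReal.sub_le_sub (hK 0) le_rfl) (le_trans (le_of_eq ?_) h2)
        rw [← EReal.coe_sub, ← EReal.coe_add]; congr 1; ring
    intro i g hg
    refine Fin.cases (fun hg => ?_) (fun i hg => ?_) i hg
    · refine le_trans (EReal.coe_le_coe_iff.mpr ?_) (hhead g hg)
      have := le_max_left (-R) (C + D)
      linarith
    · have h1 := (hC (fun j => c j.succ) i g hg).trans htail
      rw [← EReal.sub_le_iff_le_add (Or.inl (EReal.coe_ne_bot _)) (Or.inl (EReal.coe_ne_top _)),
        ← EReal.coe_sub] at h1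
      refine le_trans (EReal.coe_le_coe_iff.mpr ?_) h1
      have := le_max_right (-R) (C + D)
      linarith

/-- Linear functionals on a finite-dimensional filtered vector space are bounded. -/
theorem exists_functional_bound [Module.Finite (LamUp κ Γ) V] (ζ : Module.Dual (LamUp κ Γ) V) :
    ∃ C : ℝ, ∀ (x : V) (g : Γ), (ζ x).coeff g ≠ 0 → ((-g - C : ℝ) : EReal) ≤ ρ x := by
  let v := Module.finBasis (LamUp κ Γ) V
  obtain ⟨C, hC⟩ := hρ.exists_coordinate_bound v v.linearIndependent
  choose m hm using fun i => (ζ (v i)).exists_lower_bound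
  obtain ⟨M, hM⟩ := (Set.finite_range m).bddBelow
  refine ⟨C - M, fun x g hg => ?_⟩
  rw [← v.sum_repr x, map_sum] at hg
  obtain ⟨i, -, hi⟩ := LamUp.exists_coeff_sum_ne_zero _ _ _ hg
  rw [map_smul, smul_eq_mul] at hi
  obtain ⟨g1, g2, h1, h2, rfl⟩ := LamUp.exists_of_coeff_mul_ne_zero _ _ _ hi
  have h3 := hC (fun j => v.repr x j) i g1 h1
  rw [v.sum_repr x] at h3
  refine le_trans (EReal.coe_le_coe_iff.mpr ?_) h3
  have h4 : M ≤ m i := hM ⟨i, rfl⟩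
  have h5 := hm i g2 h2
  rw [AddSubgroup.coe_add]
  linarith

theorem dualNorm_ne_bot [Module.Finite (LamUp κ Γ) V] (ζ : NovDual κ Γ V) :
    dualNorm ρ ζ ≠ ⊥ := by
  obtain ⟨C, hC⟩ := hρ.exists_functional_bound ζ
  have : ((-C : ℝ) : EReal) ≤ dualNorm ρ ζ := by
    refine le_iInf₂ fun x hx => ?_
    obtain ⟨r, hr⟩ := hρ.exists_coe_eq hx
    have h1 : ((-C - r : ℝ) : EReal) ≤ nuUp (ζ x) := by
      refine le_iInf₂ fun g hg => ?_
      have := hC x g hg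
      rw [hr, EReal.coe_le_coe_iff] at this
      exact EReal.coe_le_coe_iff.mpr (by linarith)
    rw [hr]
    refine le_trans (le_of_eq ?_) (add_le_add h1 le_rfl)
    rw [← EReal.coe_add]; congr 1; ring
  intro h
  rw [h] at this
  exact EReal.coe_ne_bot _ (le_bot_iff.mp this)

/-- The dual filtration function is, up to sign, a filtration function on the dual. -/
theorem neg_dualNorm [Module.Finite (LamUp κ Γ) V] :
    IsNormUp κ Γ (V := Module.Dual (LamUp κ Γ) V)
      fun ζ => -dualNorm ρ (ζ : NovDual κ Γ V) where
  ne_top ζ h := hρ.dualNorm_ne_bot ζ (by simpa using h)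
  eq_bot_iff ζ := by
    rw [EReal.neg_eq_bot_iff]
    exact hρ.dualNorm_eq_top_iff ζ
  smul c ζ := by
    by_cases hc : c = 0
    · rw [hc, zero_smul, LamUp.nuUp_zero]
      have h0 := (hρ.dualNorm_eq_top_iff (0 : NovDual κ Γ V)).mpr rfl
      have h1 : dualNorm ρ (show NovDual κ Γ V from (0 : Module.Dual (LamUp κ Γ) V)) = ⊤ := h0
      rw [h1, EReal.neg_top, EReal.sub_top]
    · obtain ⟨g, -, hg⟩ := LamUp.exists_coeff_ne_zero_nuUp_eq hc
      obtain ⟨g', -, hg'⟩ := LamUp.exists_coeff_ne_zero_nuUp_eq (inv_ne_zero hc)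
      have hgg : (0 : ℝ) ≤ g + g' := by
        have := LamUp.nuUp_mul_le hc (inv_ne_zero hc)
        rw [mul_inv_cancel₀ hc, hg, hg', ← EReal.coe_add] at this
        exact EReal.coe_le_coe_iff.mp (LamUp.zero_le_nuUp_one.trans this)
      -- The inequalities for c and for c⁻¹ have total shift g + g' ≥ 0, so together they force
      -- equality.
      have hle := add_dualNorm_le (ρ := ρ) c ζ
      have hle' := add_dualNorm_le (ρ := ρ) c⁻¹ (c • ζ)
      rw [smul_smul, inv_mul_cancel₀ hc, one_smul, hg'] at hle'
      rw [hg] at hle ⊢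
      have hζ := hρ.dualNorm_ne_bot ζ
      have hcζ := hρ.dualNorm_ne_bot (c • ζ : Module.Dual (LamUp κ Γ) V)
      generalize dualNorm ρ (ζ : NovDual κ Γ V) = a at *
      generalize dualNorm ρ (c • ζ : Module.Dual (LamUp κ Γ) V) = b at *
      induction a <;> induction b <;> simp_all [← EReal.coe_add, ← EReal.coe_sub, ← EReal.coe_neg]
      linarith
  add_le ζ ξ := by
    have hmin : min (dualNorm ρ (ζ : NovDual κ Γ V)) (dualNorm ρ (ξ : NovDual κ Γ V)) ≤
        dualNorm ρ (ζ + ξ : Module.Dual (LamUp κ Γ) V) := by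
      refine le_iInf₂ fun x hx => ?_
      have h1 : dualNorm ρ (ζ : NovDual κ Γ V) ≤ nuUp (ζ x) + ρ x := iInf₂_le x hx
      have h2 : dualNorm ρ (ξ : NovDual κ Γ V) ≤ nuUp (ξ x) + ρ x := iInf₂_le x hx
      refine (min_le_min h1 h2).trans ?_
      rw [min_add_add_right]
      exact add_le_add (LamUp.min_le_nuUp_add _ _) le_rfl
    rcases min_le_iff.mp hmin with h | h
    · exact (EReal.neg_le_neg_iff.mpr h).trans (le_max_left _ _)
    · exact (EReal.neg_le_neg_iff.mpr h).trans (le_max_right _ _)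

end IsNormUp

end Filtered

/-! ### Conjugation -/

section Conj

variable (κ : Type*) [Field κ] (Γ : AddSubgroup ℝ)

theorem conj_single (g : Γ) (c : κ) :
    conj κ Γ (AddMonoidAlgebra.single g c) = AddMonoidAlgebra.single (-g) c := by
  simp [conj]

theorem conj_conj (x : Lam κ Γ) : conj κ Γ (conj κ Γ x) = x := by
  induction x using AddMonoidAlgebra.induction_linear with
  | zero => simp
  | add x y hx hy => rw [map_add, map_add, hx, hy]
  | single a r => rw [conj_single, conj_single, neg_neg]

theorem conj_injective : Function.Injective (conj κ Γ) :=
  Function.LeftInverse.injective (conj_conj κ Γ)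

theorem conj_coeff (x : Lam κ Γ) (g : Γ) : (conj κ Γ x).coeff g = x.coeff (-g) := by
  induction x using AddMonoidAlgebra.induction_linear with
  | zero => simp
  | add x y hx hy =>
    rw [map_add, AddMonoidAlgebra.coeff_add, AddMonoidAlgebra.coeff_add, Finsupp.add_apply,
      Finsupp.add_apply, hx, hy]
  | single a r =>
    classical
    rw [conj_single, AddMonoidAlgebra.coeff_single, AddMonoidAlgebra.coeff_single,
      Finsupp.single_apply, Finsupp.single_apply]
    simp only [neg_eq_iff_eq_neg]

theorem conjDown_injective : Function.Injective (conjDown κ Γ) := fun x y h => by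
  refine Subtype.ext (HahnSeries.ext (funext fun g => ?_))
  have h1 := conjDown_coeff κ Γ x (-(OrderDual.ofDual g))
  have h2 := conjDown_coeff κ Γ y (-(OrderDual.ofDual g))
  rw [h, h2, neg_neg] at h1
  exact h1.symm

/-- Negation, from `Γ` to `Γ` with the reversed order. -/
def dualNeg : Γ →+ Γᵒᵈ where
  toFun g := OrderDual.toDual (-g)
  map_zero' := by simp
  map_add' a b := by simp; abel

theorem conjDown_surjective : Function.Surjective (conjDown κ Γ) := by
  intro y
  have hinj : Function.Injective (dualNeg Γ) := fun _ _ h => neg_injective (OrderDual.toDual.injective h)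
  have hle : ∀ a b, dualNeg Γ a ≤ dualNeg Γ b ↔ a ≤ b := fun a b =>
    (neg_le_neg_iff (a := b) (b := a) : -b ≤ -a ↔ a ≤ b)
  have hw : ∀ a, weightDown Γ (dualNeg Γ a) = weightUp Γ a := fun a => by
    change -((-a : Γ) : ℝ) = a
    simp
  refine ⟨novikovReindex κ (weightUp Γ) (weightUp_mono Γ) (weightDown Γ) (weightDown_mono Γ)
    (dualNeg Γ) hinj hle hw y, LamUp.ext fun g => ?_⟩
  refine (conjDown_coeff κ Γ _ g).trans ?_
  exact novikovReindex_coeff κ (weightUp Γ) (weightUp_mono Γ) (weightDown Γ) (weightDown_mono Γ)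
    (dualNeg Γ) hinj hle hw y g

variable {κ Γ} in
theorem nuUp_conjDown (x : LamDown κ Γ) : nuUp (conjDown κ Γ x) = -nuDown x := by
  refine le_antisymm ?_ (le_iInf₂ fun g hg => ?_)
  · rw [EReal.le_neg]
    refine iSup₂_le fun g hg => ?_
    rw [EReal.le_neg]
    refine (LamUp.nuUp_le (g := -g) ?_).trans (le_of_eq ?_)
    · rwa [conjDown_coeff, neg_neg]
    · rw [← EReal.coe_neg]; simp
  · rw [EReal.neg_le]
    rw [conjDown_coeff] at hg
    refine le_trans (le_of_eq ?_)
      (le_iSup₂ (f := fun (g : Γ) (_ : x.coeff g ≠ 0) => ((g : ℝ) : EReal)) (-g) hg)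
    simp

end Conj

/-! ### Linear independence from orthogonality. -/

section Orthogonal

variable {κ : Type*} [Field κ] {Γ : AddSubgroup ℝ}

theorem IsNormUp.linearIndependent_of_orthogonal {V : Type*} [AddCommGroup V]
    [Module (LamUp κ Γ) V] {ρ : V → EReal} (hρ : IsNormUp κ Γ ρ) {d : ℕ} {v : Fin d → V}
    (hv : ∀ i, v i ≠ 0)
    (h : ∀ c : Fin d → LamUp κ Γ, ρ (∑ i, c i • v i) = ⨆ i, (ρ (v i) - nuUp (c i))) :
    LinearIndependent (LamUp κ Γ) v := by
  rw [Fintype.linearIndependent_iff]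
  intro c hc i
  by_contra hci
  have h1 := h c
  rw [hc, hρ.map_zero] at h1
  have h2 := le_iSup (fun i => ρ (v i) - nuUp (c i)) i
  rw [← h1] at h2
  obtain ⟨r, hr⟩ := hρ.exists_coe_eq (hv i)
  obtain ⟨g, -, hg⟩ := LamUp.exists_coeff_ne_zero_nuUp_eq hci
  rw [hr, hg, ← EReal.coe_sub] at h2
  exact EReal.coe_ne_bot _ (le_bot_iff.mp h2)

theorem IsWeightedOrthogonal.linearIndependent {F : Type*} [AddCommGroup F] [Module (Lam κ Γ) F]
    [Module.Free (Lam κ Γ) F] {s : ℝ} {p : F → EReal} {d : ℕ} {e : Fin d → F}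
    (h : IsWeightedOrthogonal (κ := κ) (Γ := Γ) s p e)
    (hp : IsWeightedNorm (κ := κ) (Γ := Γ) s p) (he : ∀ i, e i ≠ 0) :
    LinearIndependent (Lam κ Γ) e := by
  rw [Fintype.linearIndependent_iff]
  intro c hc i
  by_contra hci
  obtain ⟨g, hg⟩ := exists_coeff_ne_zero hci
  obtain ⟨r, hr⟩ := hp.exists_coe_eq (he i)
  have h1 := h c i g hg
  rw [hc, hp.map_zero, hr, ← EReal.coe_sub] at h1
  exact EReal.coe_ne_bot _ (le_bot_iff.mp h1)

end Orthogonal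

/-! ### The conjugated dual as a space of functionals over Λ_↑. -/

section ToDual

variable {κ : Type*} [Field κ] {Γ : AddSubgroup ℝ} {V : Type*} [AddCommGroup V]
  [Module (LamUp κ Γ) V]

/-- The `Λ_↑`-linear functional underlying an element of the conjugated dual. -/
def NovDual.toDual : NovDual κ Γ V →+ Module.Dual (LamUp κ Γ) V := AddMonoidHom.id _

theorem NovDual.toDual_apply (ζ : NovDual κ Γ V) (x : V) : ζ.toDual x = ζ x := rfl

theorem NovDual.toDual_smul (c : LamDown κ Γ) (ζ : NovDual κ Γ V) :
    (c • ζ).toDual = conjDown κ Γ c • ζ.toDual := rfl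

theorem NovDual.toDual_lam_smul (c : Lam κ Γ) (ζ : NovDual κ Γ V) :
    (c • ζ).toDual = incUp κ Γ (conj κ Γ c) • ζ.toDual := by
  rw [← conjDown_incDown]; rfl

/-- The filtration function `-ᵛρ` on the space of functionals. -/
def negDualNorm (ρ : V → EReal) (ζ : Module.Dual (LamUp κ Γ) V) : EReal :=
  -⨅ (x : V) (_ : x ≠ 0), nuUp (ζ x) + ρ x

theorem dualNorm_eq_neg (ρ : V → EReal) (ζ : NovDual κ Γ V) :
    dualNorm ρ ζ = -negDualNorm ρ ζ.toDual := by
  rw [negDualNorm, neg_neg]; rfl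

theorem IsNormUp.negDualNorm [DiscreteTopology Γ] [Module.Finite (LamUp κ Γ) V] {ρ : V → EReal}
    (hρ : IsNormUp κ Γ ρ) : IsNormUp κ Γ (negDualNorm (κ := κ) (Γ := Γ) ρ) :=
  hρ.neg_dualNorm

end ToDual

/-! ### Torsion-freeness over Λ of the spaces over the Novikov fields. -/

section TorsionFree

variable {κ : Type*} [Field κ] {Γ : AddSubgroup ℝ}

theorem isTorsionFree_of_tower [DiscreteTopology Γ] {V : Type*} [AddCommGroup V]
    [Module (LamUp κ Γ) V] [Module (Lam κ Γ) V] [IsScalarTower (Lam κ Γ) (LamUp κ Γ) V] :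
    Module.IsTorsionFree (Lam κ Γ) V := by
  refine Module.IsTorsionFree.of_smul_eq_zero fun c v h => ?_
  rw [← algebraMap_smul (LamUp κ Γ) c v,
    smul_eq_zero (R := LamUp κ Γ)] at h
  refine h.imp_left fun h => LamUp.incUp_injective ?_
  rw [map_zero]; exact h

instance isTorsionFree_novDual [DiscreteTopology Γ] {V : Type*} [AddCommGroup V]
    [Module (LamUp κ Γ) V] : Module.IsTorsionFree (Lam κ Γ) (NovDual κ Γ V) := by
  refine Module.IsTorsionFree.of_smul_eq_zero fun c ζ h => ?_
  by_cases hc : c = 0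
  · exact Or.inl hc
  right
  refine DFunLike.ext _ _ fun x => ?_
  have h1 : (c • ζ) x = conjDown κ Γ (incDown κ Γ c) * ζ x := rfl
  rw [h, conjDown_incDown] at h1
  have h2 : incUp κ Γ (conj κ Γ c) ≠ 0 := by
    intro h0
    refine hc (conj_injective κ Γ (LamUp.incUp_injective ?_))
    rw [h0, map_zero, map_zero]
  exact (mul_eq_zero.mp h1.symm).resolve_left h2

theorem torsion_le_ker {R M N : Type*} [CommRing R] [IsDomain R] [AddCommGroup M] [Module R M]
    [AddCommGroup N] [Module R N] [Module.IsTorsionFree R N] (f : M →ₗ[R] N) :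
    Submodule.torsion R M ≤ LinearMap.ker f := by
  intro x hx
  obtain ⟨a, ha⟩ := (Submodule.mem_torsion_iff x).mp hx
  have h1 : (a : R) • f x = 0 := by
    rw [← map_smul]; exact (congrArg f ha).trans (map_zero f)
  exact (smul_eq_zero.mp h1).resolve_left (nonZeroDivisors.coe_ne_zero a)

end TorsionFree

/-! ### Duality up to denominators. -/

namespace WeakPDStructure

variable {κ : Type*} [Field κ] {Γ : AddSubgroup ℝ} {n : ℤ} {H : ℤ → Type*}
  [∀ k, AddCommGroup (H k)] [∀ k, Module (Lam κ Γ) (H k)] (P : WeakPDStructure κ Γ n H)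

/-- Surjectivity over the fraction field, with denominators cleared twice: `s` for the preimage, and
`c` to turn an equality in the localization into one in the dual. -/
theorem exists_smul_eq_D (k j : ℤ) (h : k + j = n) (φ : ConjDual κ Γ (H j)) :
    ∃ (c : Lam κ Γ) (x : H k), c ≠ 0 ∧ c • φ = P.D k j h x := by
  let K := FractionRing (Lam κ Γ)
  obtain ⟨z, hz⟩ := (P.bijective k j h).2 (TensorProduct.mk (Lam κ Γ) K _ 1 φ)
  obtain ⟨⟨x, s⟩, hx⟩ := IsLocalizedModule.surj (nonZeroDivisors (Lam κ Γ))
    (TensorProduct.mk (Lam κ Γ) K (H k) 1) z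
  have h1 : TensorProduct.mk (Lam κ Γ) K (ConjDual κ Γ (H j)) 1 (P.D k j h x) =
      TensorProduct.mk (Lam κ Γ) K (ConjDual κ Γ (H j)) 1 ((s : Lam κ Γ) • φ) := by
    have h2 : LinearMap.baseChange K (P.D k j h) ((s : Lam κ Γ) • z) =
        (s : Lam κ Γ) • LinearMap.baseChange K (P.D k j h) z :=
      map_smul ((LinearMap.baseChange K (P.D k j h)).restrictScalars (Lam κ Γ)) (s : Lam κ Γ) z
    rw [hz] at h2
    rw [map_smul, ← h2]
    have h3 : (s : Lam κ Γ) • z = TensorProduct.mk (Lam κ Γ) K (H k) 1 x := hx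
    rw [h3]
    rfl
  obtain ⟨c, hc⟩ := IsLocalizedModule.exists_of_eq (S := nonZeroDivisors (Lam κ Γ)) h1
  refine ⟨c * s, (c : Lam κ Γ) • x, ?_, ?_⟩
  · exact mul_ne_zero (nonZeroDivisors.coe_ne_zero c) (nonZeroDivisors.coe_ne_zero s)
  · rw [map_smul, mul_smul]
    exact hc.symm

end WeakPDStructure

/-! ### Doubly-orthogonal bases of Poincaré–Novikov structures -/

namespace WeakPNStructure

variable {κ : Type*} [Field κ] {Γ : AddSubgroup ℝ} [DiscreteTopology Γ] {n : ℤ} {H : ℤ → Type*}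
  [∀ k, AddCommGroup (H k)] [∀ k, Module (Lam κ Γ) (H k)] {P : WeakPDStructure κ Γ n H}
  (N : WeakPNStructure P)

/-- The map induced by `S_k` on `H_k` modulo torsion. -/
def redS (k : ℤ) : (H k ⧸ Submodule.torsion (Lam κ Γ) (H k)) →ₗ[Lam κ Γ] N.V k :=
  haveI : Module.IsTorsionFree (Lam κ Γ) (N.V k) := isTorsionFree_of_tower
  (Submodule.torsion (Lam κ Γ) (H k)).liftQ (N.S k) (torsion_le_ker _)

theorem redS_mkQ (k : ℤ) (x : H k) : N.redS k (Submodule.mkQ _ x) = N.S k x := rfl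

/-- The map induced by `S̃_k` on `H_k` modulo torsion. -/
def redStilde (k : ℤ) :
    (H k ⧸ Submodule.torsion (Lam κ Γ) (H k)) →ₗ[Lam κ Γ] NovDual κ Γ (N.V (n - k)) :=
  (Submodule.torsion (Lam κ Γ) (H k)).liftQ (N.Stilde k) (torsion_le_ker _)

theorem redStilde_mkQ (k : ℤ) (x : H k) :
    N.redStilde k (Submodule.mkQ _ x) = N.Stilde k x := rfl

theorem map_smul_eq (k : ℤ) (c : Lam κ Γ) (x : N.V k) : c • x = incUp κ Γ c • x :=
  (algebraMap_smul (LamUp κ Γ) c x).symm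

/-- Boundedness holds because a functional on H_k modulo torsion extends to V_k, where functionals
are bounded. -/
theorem isWeightedNorm_up (k : ℤ) :
    IsWeightedNorm (κ := κ) (Γ := Γ) 1 fun x => N.ρ k (N.redS k x) where
  map_zero := by rw [map_zero]; exact (N.isNormUp k).map_zero
  ne_top x := (N.isNormUp k).ne_top _
  add_le x y := by rw [map_add]; exact (N.isNormUp k).add_le _ _
  single_smul_le g c x := by
    rw [map_smul, map_smul_eq, (N.isNormUp k).smul]
    refine EReal.sub_le_sub le_rfl (le_iInf₂ fun g' hg' => ?_)
    rw [LamUp.incUp_coeff, AddMonoidAlgebra.coeff_single] at hg'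
    have : g' = g := by
      by_contra h
      exact hg' (Finsupp.single_eq_of_ne h)
    rw [this, one_mul]
  bounded φ := by
    have := N.finite k
    let ψ : ConjDual κ Γ (H k) := φ.comp (Submodule.mkQ _)
    obtain ⟨C, hC⟩ := (N.isNormUp k).exists_functional_bound (dualLift (N.isBaseChange k) ψ)
    refine ⟨C, fun x g hg => ?_⟩
    obtain ⟨h, rfl⟩ := Submodule.mkQ_surjective _ x
    rw [redS_mkQ, one_mul]
    refine hC (N.S k h) g ?_
    rw [dualLift_apply]
    exact fun h0 => hg ((LamUp.incUp_coeff (ψ h) g).symm.trans h0)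

/-- For boundedness, a functional ψ on H_k satisfies c ψ = D y for some y in H_{n-k} and c ≠ 0. By
symmetry (S̃x)(Sy) = ±c·conj(ψ x), so the single vector Sy in the infimum defining ᵛρ(S̃x) already
controls ψ x. -/
theorem isWeightedNorm_down (k : ℤ) :
    IsWeightedNorm (κ := κ) (Γ := Γ) (-1)
      fun x => negDualNorm (N.ρ (n - k)) (N.redStilde k x).toDual := by
  have := N.finite (n - k)
  have hN := (N.isNormUp (n - k)).negDualNorm
  refine ⟨?_, fun x => hN.ne_top _, fun x y => ?_, fun g c x => ?_, fun φ => ?_⟩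
  · rw [map_zero, map_zero]; exact hN.map_zero
  · rw [map_add, map_add]; exact hN.add_le _ _
  · rw [map_smul, NovDual.toDual_lam_smul, hN.smul, conj_single]
    refine EReal.sub_le_sub le_rfl (le_iInf₂ fun g' hg' => ?_)
    rw [LamUp.incUp_coeff, AddMonoidAlgebra.coeff_single] at hg'
    have : g' = -g := by
      by_contra h
      exact hg' (Finsupp.single_eq_of_ne h)
    rw [this]; simp
  · let ψ : ConjDual κ Γ (H k) := φ.comp (Submodule.mkQ _)
    obtain ⟨c, y, hc, hy⟩ := P.exists_smul_eq_D (n - k) k (by ring) ψ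
    have hval : ∀ x, incUp κ Γ (P.D k (n - k) (by ring) x y) =
          incUp κ Γ c * incUp κ Γ (conj κ Γ (ψ x)) ∨
        incUp κ Γ (P.D k (n - k) (by ring) x y) =
          -(incUp κ Γ c * incUp κ Γ (conj κ Γ (ψ x))) := by
      intro x
      have h1 : P.D (n - k) k (by ring) y x = conj κ Γ c * ψ x := by rw [← hy]; rfl
      have h2 : conj κ Γ (P.D (n - k) k (by ring) y x) = c * conj κ Γ (ψ x) := by
        rw [h1, map_mul, conj_conj]
      rcases P.symmetric k (n - k) (by ring) (by ring) with h | h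
      · left; rw [h, h2, map_mul]
      · right; rw [h, h2, map_neg, map_mul]
    have hc' : incUp κ Γ c ≠ 0 := fun h => hc (LamUp.incUp_injective (h.trans (map_zero _).symm))
    have hψ : ∀ x g, (φ (Submodule.mkQ _ x)).coeff g ≠ 0 →
        (incUp κ Γ (conj κ Γ (ψ x))).coeff (-g) ≠ 0 := by
      intro x g hg
      rw [LamUp.incUp_coeff, conj_coeff, neg_neg]
      exact hg
    obtain ⟨g0, -, hg0⟩ := LamUp.exists_coeff_ne_zero_nuUp_eq hc'
    have hnu : ∀ x g, (φ (Submodule.mkQ _ x)).coeff g ≠ 0 →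
        nuUp (incUp κ Γ (P.D k (n - k) (by ring) x y)) ≤ ((g0 - g : ℝ) : EReal) := by
      intro x g hg
      have h0 := hψ x g hg
      have h3 : incUp κ Γ (conj κ Γ (ψ x)) ≠ 0 := fun h => h0 (by rw [h]; rfl)
      have h4 := (LamUp.nuUp_mul_le hc' h3).trans (add_le_add hg0.le (LamUp.nuUp_le h0))
      rw [← EReal.coe_add] at h4
      have h5 : nuUp (incUp κ Γ (P.D k (n - k) (by ring) x y)) =
          nuUp (incUp κ Γ c * incUp κ Γ (conj κ Γ (ψ x))) := by
        rcases hval x with h | h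
        · rw [h]
        · rw [h, LamUp.nuUp_neg]
      rw [h5]
      refine h4.trans (le_of_eq ?_)
      simp [sub_eq_add_neg]
    have hS : ∀ x, N.Stilde k x (N.S (n - k) y) = incUp κ Γ (P.D k (n - k) (by ring) x y) :=
      fun x => N.Stilde_apply k x y
    -- The infimum runs over nonzero vectors only. If Sy = 0 then ψ vanishes and any constant will
    -- do.
    by_cases hy0 : N.S (n - k) y = 0
    · refine ⟨0, fun x g hg => ?_⟩
      obtain ⟨x, rfl⟩ := Submodule.mkQ_surjective _ x
      exfalso
      have h1 := hnu x g hg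
      rw [← hS, hy0] at h1
      have h2 : N.Stilde k x 0 = 0 :=
        LinearMap.map_zero (show Module.Dual (LamUp κ Γ) (N.V (n - k)) from N.Stilde k x)
      rw [h2, LamUp.nuUp_zero] at h1
      exact EReal.coe_ne_top _ (top_le_iff.mp h1)
    · obtain ⟨r, hr⟩ := (N.isNormUp (n - k)).exists_coe_eq hy0
      -- With g0 = ν(c) and r = ρ(Sy), the infimum is at most (g0 - g) + r; its negative is -(s g) -
      -- (g0 + r) for s = -1.
      refine ⟨g0 + r, fun x g hg => ?_⟩
      obtain ⟨x, rfl⟩ := Submodule.mkQ_surjective _ x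
      rw [redStilde_mkQ, ← neg_neg (negDualNorm _ _), ← dualNorm_eq_neg, EReal.le_neg]
      have h1 : dualNorm (N.ρ (n - k)) (N.Stilde k x) ≤
          nuUp (N.Stilde k x (N.S (n - k) y)) + N.ρ (n - k) (N.S (n - k) y) :=
        iInf₂_le (N.S (n - k) y) hy0
      rw [hS, hr] at h1
      refine (h1.trans (add_le_add (hnu x g hg) le_rfl)).trans (le_of_eq ?_)
      rw [← EReal.coe_add, ← EReal.coe_neg]
      congr 1; ring

theorem span_range_S (k : ℤ) : Submodule.span (LamUp κ Γ) (Set.range (N.S k)) = ⊤ := by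
  rw [eq_top_iff]
  intro x _
  induction x using (N.isBaseChange k).inductionOn with
  | zero => exact Submodule.zero_mem _
  | tmul x => exact Submodule.subset_span ⟨x, rfl⟩
  | smul c x hx => exact Submodule.smul_mem _ _ (hx trivial)
  | add x y hx hy => exact Submodule.add_mem _ (hx trivial) (hy trivial)

theorem span_S_eq_top {k : ℤ} {d : ℕ} {e : Fin d → H k}
    (he : Submodule.span (Lam κ Γ)
      (Set.range fun i => (Submodule.torsion (Lam κ Γ) (H k)).mkQ (e i)) = ⊤) :
    Submodule.span (LamUp κ Γ) (Set.range fun i => N.S k (e i)) = ⊤ := by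
  rw [eq_top_iff, ← N.span_range_S k, Submodule.span_le]
  rintro _ ⟨x, rfl⟩
  have hx : (Submodule.torsion (Lam κ Γ) (H k)).mkQ x ∈ Submodule.span (Lam κ Γ)
      (Set.range fun i => (Submodule.torsion (Lam κ Γ) (H k)).mkQ (e i)) := he ▸ trivial
  obtain ⟨c, hc⟩ := (Submodule.mem_span_range_iff_exists_fun _).mp hx
  rw [SetLike.mem_coe, ← redS_mkQ, ← hc, map_sum]
  refine Submodule.sum_mem _ fun i _ => ?_
  rw [map_smul, map_smul_eq]
  exact Submodule.smul_mem _ _ (Submodule.subset_span ⟨i, rfl⟩)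

/-- The denominator c of `exists_smul_eq_D` becomes invertible in Λ^↓; its inverse is taken in Λ_↑
and carried back by conjugation. -/
theorem exists_smul_dualExtension (k : ℤ) (φ : ConjDual κ Γ (H (n - k))) :
    ∃ (u : LamDown κ Γ) (z : H k),
      dualExtension (N.isBaseChange (n - k)) φ = u • N.Stilde k z := by
  obtain ⟨c, z, hc, hz⟩ := P.exists_smul_eq_D k (n - k) (by ring) φ
  obtain ⟨u, hu⟩ := conjDown_surjective κ Γ (conjDown κ Γ (incDown κ Γ c))⁻¹
  refine ⟨u, z, ?_⟩
  have h1 : N.Stilde k z = c • dualExtension (N.isBaseChange (n - k)) φ := by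
    rw [← map_smul, hz]; rfl
  have h2 : c • dualExtension (N.isBaseChange (n - k)) φ =
      incDown κ Γ c • dualExtension (N.isBaseChange (n - k)) φ := rfl
  have h3 : u * incDown κ Γ c = 1 := by
    apply conjDown_injective κ Γ
    rw [map_mul, hu, map_one, inv_mul_cancel₀]
    rw [conjDown_incDown]
    intro h0
    exact hc (conj_injective κ Γ (LamUp.incUp_injective (by rw [h0, map_zero, map_zero])))
  rw [h1, h2, smul_smul, h3, one_smul]

/-- A functional on V_{n-k} is a combination of the extensions of a dual basis of H_{n-k} modulo
torsion, and each of these is a Λ^↓-multiple of some S̃z. -/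
theorem span_Stilde_eq_top {k : ℤ} {d : ℕ} {e : Fin d → H k}
    (he : Submodule.span (Lam κ Γ)
      (Set.range fun i => (Submodule.torsion (Lam κ Γ) (H k)).mkQ (e i)) = ⊤) :
    Submodule.span (LamDown κ Γ) (Set.range fun i => N.Stilde k (e i)) = ⊤ := by
  set W := Submodule.span (LamDown κ Γ) (Set.range fun i => N.Stilde k (e i))
  have hW : ∀ x, N.Stilde k x ∈ W := by
    intro x
    have hx : (Submodule.torsion (Lam κ Γ) (H k)).mkQ x ∈ Submodule.span (Lam κ Γ)
        (Set.range fun i => (Submodule.torsion (Lam κ Γ) (H k)).mkQ (e i)) := he ▸ trivial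
    obtain ⟨c, hc⟩ := (Submodule.mem_span_range_iff_exists_fun _).mp hx
    rw [← redStilde_mkQ, ← hc, map_sum]
    refine Submodule.sum_mem _ fun i _ => ?_
    rw [map_smul]
    exact Submodule.smul_mem W (incDown κ Γ (c i)) (Submodule.subset_span ⟨i, rfl⟩)
  have := P.finite (n - k)
  let b := Module.Free.chooseBasis (Lam κ Γ)
    (H (n - k) ⧸ Submodule.torsion (Lam κ Γ) (H (n - k)))
  let φ := fun l => (show ConjDual κ Γ (H (n - k)) from (b.coord l).comp (Submodule.mkQ _))
  have hφ : ∀ l, dualExtension (N.isBaseChange (n - k)) (φ l) ∈ W := by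
    intro l
    obtain ⟨u, z, hz⟩ := N.exists_smul_dualExtension k (φ l)
    rw [hz]
    exact Submodule.smul_mem _ _ (hW z)
  rw [eq_top_iff]
  intro ζ _
  choose u hu using fun l => conjDown_surjective κ Γ (ζ (N.redS (n - k) (b l)))
  have hζ : ζ = ∑ l, u l • dualExtension (N.isBaseChange (n - k)) (φ l) := by
    refine (N.isBaseChange (n - k)).algHom_ext
      (show Module.Dual (LamUp κ Γ) (N.V (n - k)) from ζ)
      (∑ l, conjDown κ Γ (u l) • dualLift (N.isBaseChange (n - k)) (φ l)) fun h => ?_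
    rw [LinearMap.sum_apply]
    conv_lhs => rw [← redS_mkQ, ← b.sum_repr (Submodule.mkQ _ h), map_sum, map_sum]
    refine Finset.sum_congr rfl fun l _ => ?_
    rw [LinearMap.smul_apply, dualLift_apply, hu, map_smul, map_smul_eq, map_smul, smul_eq_mul,
      smul_eq_mul, mul_comm]
    rfl
  rw [hζ]
  exact Submodule.sum_mem _ fun l _ => Submodule.smul_mem _ _ (hφ l)

theorem exists_isDoublyOrthogonalBasis (k : ℤ) :
    ∃ (d : ℕ) (e : Fin d → H k) (a b : Fin d → ℝ),
      IsDoublyOrthogonalBasis (N.S k) (N.ρ k) (N.Stilde k) (dualNorm (N.ρ (n - k))) e ∧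
      (∀ i, N.ρ k (N.S k (e i)) = a i) ∧
      ∀ i, dualNorm (N.ρ (n - k)) (N.Stilde k (e i)) = b i := by
  have := P.finite k
  have := N.finite (n - k)
  have hp := N.isWeightedNorm_up k
  have hq := N.isWeightedNorm_down k
  have hρ := N.isNormUp k
  have hδ := (N.isNormUp (n - k)).negDualNorm
  obtain ⟨d, e', hne, hspan, horp, horq⟩ := IsWeightedNorm.exists_common_orthogonal _ hp hq rfl
  choose e he using fun i => Submodule.mkQ_surjective _ (e' i)
  obtain rfl : e' = fun i => Submodule.mkQ _ (e i) := (funext he).symm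
  choose a ha using fun i => hp.exists_coe_eq (hne i)
  choose b hb using fun i => hq.exists_coe_eq (hne i)
  simp only [redS_mkQ] at ha
  simp only [redStilde_mkQ] at hb
  have hup := hρ.eq_iSup_of_orthogonal (v := fun i => N.S k (e i)) (by
    intro c i g hg
    have := horp c i g hg
    simp only [map_sum, map_smul, redS_mkQ, one_mul, map_smul_eq] at this
    exact this)
  have hdown := hδ.eq_iSup_of_orthogonal (v := fun i => (N.Stilde k (e i)).toDual) (by
    intro c i g hg
    -- S̃ is conjugate-linear into functionals, so coefficients are conjugated and g is replaced by
    -- -g to reach the ordinary form of orthogonality.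
    have h1 := horq (fun j => conj κ Γ (c j)) i (-g) (by rw [conj_coeff, neg_neg]; exact hg)
    simp only [map_sum, map_smul, redStilde_mkQ, NovDual.toDual_lam_smul, conj_conj] at h1
    simpa using h1)
  have hSne : ∀ i, N.S k (e i) ≠ 0 := by
    intro i h0
    have := ha i
    rw [h0, hρ.map_zero] at this
    exact EReal.coe_ne_bot _ this.symm
  have hwne : ∀ i, (N.Stilde k (e i)).toDual ≠ 0 := by
    intro i h0
    have := hb i
    rw [h0, hδ.map_zero] at this
    exact EReal.coe_ne_bot _ this.symm
  refine ⟨d, e, a, fun i => -b i, ⟨horp.linearIndependent hp hne, hspan, ⟨?_, ?_, hup⟩,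
    ⟨?_, ?_, ?_⟩⟩, ha, fun i => by rw [dualNorm_eq_neg, hb, EReal.coe_neg]⟩
  · exact hρ.linearIndependent_of_orthogonal hSne hup
  · exact N.span_S_eq_top hspan
  · rw [Fintype.linearIndependent_iff]
    intro c hc i
    have hli := hδ.linearIndependent_of_orthogonal hwne hdown
    have hc' := congrArg NovDual.toDual hc
    simp only [map_sum, NovDual.toDual_smul, map_zero] at hc'
    have := Fintype.linearIndependent_iff.mp hli (fun i => conjDown κ Γ (c i)) hc' i
    exact conjDown_injective κ Γ (this.trans (map_zero _).symm)
  · exact N.span_Stilde_eq_top hspan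
  · intro c
    simp only [dualNorm_eq_neg, map_sum, NovDual.toDual_smul]
    rw [hdown fun i => conjDown κ Γ (c i)]
    -- Since q = -ᵛρ, orthogonality for the supremum turns into orthogonality for the infimum.
    have hterm : ∀ i, negDualNorm (N.ρ (n - k)) (N.Stilde k (e i)).toDual -
        nuUp (conjDown κ Γ (c i)) =
        -(-negDualNorm (N.ρ (n - k)) (N.Stilde k (e i)).toDual - nuDown (c i)) := by
      intro i
      rw [hb, nuUp_conjDown, ← EReal.coe_neg, EReal.neg_sub (Or.inl (EReal.coe_ne_bot _))
        (Or.inl (EReal.coe_ne_top _)), EReal.coe_neg, neg_neg, sub_eq_add_neg, neg_neg]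
    simp only [hterm]
    refine le_antisymm (le_iInf fun i => ?_) ?_
    · rw [EReal.neg_le]
      exact le_iSup (fun i => -(-negDualNorm (N.ρ (n - k)) (N.Stilde k (e i)).toDual -
        nuDown (c i))) i
    · rw [EReal.le_neg]
      refine iSup_le fun i => ?_
      rw [EReal.neg_le_neg_iff]
      exact iInf_le _ i

theorem exists_isEssentialBarcode : ∃ B, N.IsEssentialBarcode B := by
  choose d e a b h ha hb using N.exists_isDoublyOrthogonalBasis
  exact ⟨_, fun k => Finset.univ.val.map fun i =>
    ((QuotientAddGroup.mk (a k i) : ℝ ⧸ Γ), b k i - a k i),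
    fun k => ⟨d k, e k, a k, b k, h k, ha k, hb k, rfl⟩, fun k => rfl⟩

end WeakPNStructure

/-! ### Stability of basis spectra -/

section Matching

variable {κ : Type*} [Field κ] {Γ : AddSubgroup ℝ}

/-- Given two mutually inverse matrices over `Λ` whose nonzero coefficients only decrease the
first coordinate and increase the second up to an error `t`, the indices can be matched up to the
error `t` in both coordinates. -/
theorem exists_matching {ι ι' : Type*} [Fintype ι] [Fintype ι'] {t : ℝ} (a b : ι → ℝ)
    (a' b' : ι' → ℝ) (A : ι' → ι → Lam κ Γ) (B : ι → ι' → Lam κ Γ)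
    (hdiag : ∀ i, ∑ j, B i j * A j i = 1)
    (hoff : ∀ i i', i ≠ i' → ∑ j, B i j * A j i' = 0)
    (hA : ∀ j i (g : Γ), (A j i).coeff g ≠ 0 → a i - g ≤ a' j + t ∧ b' j ≤ b i - g + t)
    (hB : ∀ i j (g : Γ), (B i j).coeff g ≠ 0 → a' j - g ≤ a i + t ∧ b i ≤ b' j - g + t) :
    ∃ f : ι → ι', Function.Injective f ∧
      ∀ i, ∃ g : Γ, |a' (f i) - (a i - g)| ≤ t ∧ |b' (f i) - (b i - g)| ≤ t := by
  classical
  let r : ι → ι' → Prop := fun i j =>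
    ∃ g : Γ, |a' j - (a i - g)| ≤ t ∧ |b' j - (b i - g)| ≤ t
  -- By Hall's theorem it suffices to bound the size of a set `X` by that of its set `Y` of
  -- admissible partners.
  refine (Fintype.all_card_le_filter_rel_iff_exists_injective r).mp fun X => ?_
  set Y : Finset ι' := Finset.univ.filter fun j => ∃ i ∈ X, r i j with hY
  -- Suppose both factors are nonzero. As j is no partner of i', one bound from `hA` sharpens and
  -- gives b'_j - a'_j < b_i' - a_i'. As j is no partner of i, `hB` gives b_i - a_i < b'_j - a'_j.
  -- Together these contradict the assumed order of lengths.
  have hzero : ∀ i ∈ X, ∀ i' ∈ X, b i' - a i' ≤ b i - a i → ∀ j ∉ Y, B i j * A j i' = 0 := by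
    intro i hi i' hi' hle j hj
    by_contra hne
    obtain ⟨g', hg'⟩ := exists_coeff_ne_zero (left_ne_zero_of_mul hne)
    obtain ⟨g, hg⟩ := exists_coeff_ne_zero (right_ne_zero_of_mul hne)
    obtain ⟨h1, h2⟩ := hA j i' g hg
    obtain ⟨h3, h4⟩ := hB i j g' hg'
    have hj' : ∀ i ∈ X, ¬ r i j := fun i hi hr =>
      hj (Finset.mem_filter.mpr ⟨Finset.mem_univ _, i, hi, hr⟩)
    have hn1 := fun h => hj' i' hi' ⟨g, h⟩
    have hn2 := fun h => hj' i hi ⟨-g', h⟩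
    rw [AddSubgroup.coe_neg] at hn2
    rw [imp_false, abs_le, abs_le, not_and_or, not_and_or, not_and_or] at hn1 hn2
    rcases hn1 with (hn1 | hn1) | (hn1 | hn1) <;> rcases hn2 with (hn2 | hn2) | (hn2 | hn2) <;>
      rw [not_le] at hn1 hn2 <;> linarith
  have hsum : ∀ i ∈ X, ∀ i' ∈ X, b i' - a i' ≤ b i - a i →
      ∑ j : Y, B i j * A j i' = ∑ j, B i j * A j i' := by
    intro i hi i' hi' hle
    rw [Finset.sum_coe_sort Y fun j => B i j * A j i']
    exact Finset.sum_subset (Finset.subset_univ _) fun j _ hj => hzero i hi i' hi' hle j hj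
  have hli : LinearIndependent (Lam κ Γ) fun (i : X) (j : Y) => B i j := by
    rw [Fintype.linearIndependent_iff]
    intro u hu
    by_contra! hex
    obtain ⟨i0, hi0⟩ := hex
    -- Triangularity: pairing the relation with the column of `A` at the shortest index `i1`
    -- occurring in it kills every term but u i1.
    obtain ⟨i1, hi1, hmin⟩ := (Finset.univ.filter fun i : X => u i ≠ 0).exists_min_image
      (fun i => b i - a i) ⟨i0, by simp [hi0]⟩
    have hu1 : u i1 ≠ 0 := (Finset.mem_filter.mp hi1).2
    have h0 : ∑ j : Y, (∑ i : X, u i * B i j) * A j i1 = 0 := by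
      refine Finset.sum_eq_zero fun j _ => ?_
      have := congrFun hu j
      simp only [Finset.sum_apply, Pi.smul_apply, smul_eq_mul, Pi.zero_apply] at this
      rw [this, zero_mul]
    simp only [Finset.sum_mul] at h0
    rw [Finset.sum_comm] at h0
    have h1 : ∀ i : X, ∑ j : Y, u i * B i j * A j i1 = if i = i1 then u i else 0 := by
      intro i
      by_cases hui : u i = 0
      · simp [hui]
      have hle := hmin i (Finset.mem_filter.mpr ⟨Finset.mem_univ _, hui⟩)
      simp only [mul_assoc]
      rw [← Finset.mul_sum, hsum i i.2 i1 i1.2 hle]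
      split_ifs with h
      · rw [h, hdiag, mul_one]
      · rw [hoff _ _ fun h' => h (Subtype.ext h'), mul_zero]
    simp only [h1] at h0
    rw [Finset.sum_ite_eq' Finset.univ i1, if_pos (Finset.mem_univ _)] at h0
    exact hu1 h0
  have hcard := hli.fintype_card_le_finrank
  rw [Module.finrank_fintype_fun_eq_card, Fintype.card_coe, Fintype.card_coe] at hcard
  exact hcard

end Matching

/-! ### Matching of doubly-orthogonal bases along a t-morphism. -/

namespace WeakPNStructure

variable {κ : Type*} [Field κ] {Γ : AddSubgroup ℝ} {n : ℤ} {H : ℤ → Type*}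
  [∀ k, AddCommGroup (H k)] [∀ k, Module (Lam κ Γ) (H k)] {P : WeakPDStructure κ Γ n H}

/-- The inverse of a `t`-morphism. -/
def TMorphism.symm {N N' : WeakPNStructure P} {t : ℝ} (m : TMorphism N N' t) :
    TMorphism N' N t where
  a k := (m.a k).symm
  comp k x := by rw [m.comp, LinearEquiv.symm_apply_apply]
  le_add k x := by
    have := m.le_add' k ((m.a k).symm x)
    rwa [LinearEquiv.apply_symm_apply] at this
  le_add' k x := by
    have := m.le_add k ((m.a k).symm x)
    rwa [LinearEquiv.apply_symm_apply] at this

/-- The functionals S̃'x ∘ a and S̃x agree on the image of S and hence everywhere, so the two infima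
differ only through ρ' and ρ. -/
theorem TMorphism.dualNorm_le {N N' : WeakPNStructure P} {t : ℝ} (m : TMorphism N N' t) (k : ℤ)
    (x : H k) : dualNorm (N'.ρ (n - k)) (N'.Stilde k x) ≤
      dualNorm (N.ρ (n - k)) (N.Stilde k x) + (t : EReal) := by
  have hval : ∀ v, N'.Stilde k x (m.a (n - k) v) = N.Stilde k x v := by
    intro v
    have : (N'.Stilde k x).toDual.comp (m.a (n - k)).toLinearMap = (N.Stilde k x).toDual := by
      refine (N.isBaseChange (n - k)).algHom_ext _ _ fun y => ?_
      rw [LinearMap.comp_apply, LinearEquiv.coe_coe, ← m.comp, NovDual.toDual_apply,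
        NovDual.toDual_apply, Stilde_apply, Stilde_apply]
    exact LinearMap.congr_fun this v
  rw [← EReal.sub_le_iff_le_add (Or.inl (EReal.coe_ne_bot _)) (Or.inl (EReal.coe_ne_top _))]
  refine le_iInf₂ fun v hv => ?_
  rw [EReal.sub_le_iff_le_add (Or.inl (EReal.coe_ne_bot _)) (Or.inl (EReal.coe_ne_top _))]
  have hv' : m.a (n - k) v ≠ 0 := (m.a (n - k)).map_ne_zero_iff.mpr hv
  have h1 : dualNorm (N'.ρ (n - k)) (N'.Stilde k x) ≤
      nuUp (N'.Stilde k x (m.a (n - k) v)) + N'.ρ (n - k) (m.a (n - k) v) :=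
    iInf₂_le (m.a (n - k) v) hv'
  rw [hval] at h1
  refine h1.trans ?_
  rw [add_assoc]
  exact add_le_add le_rfl (m.le_add (n - k) v)

variable [DiscreteTopology Γ]

/-- The coefficients of a vector in a doubly-orthogonal basis are controlled by the filtration
levels of the vector in a structure at distance at most `t`. -/
theorem TMorphism.coeff_bound {N N' : WeakPNStructure P} {t : ℝ} (m : TMorphism N N' t) {k : ℤ}
    {d : ℕ} {e : Fin d → H k}
    (he : IsDoublyOrthogonalBasis (N.S k) (N.ρ k) (N.Stilde k) (dualNorm (N.ρ (n - k))) e)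
    {x : H k} {c : Fin d → Lam κ Γ}
    (hx : Submodule.mkQ (Submodule.torsion (Lam κ Γ) (H k)) x = ∑ i, c i • Submodule.mkQ _ (e i))
    {i : Fin d} {g : Γ} (hg : (c i).coeff g ≠ 0) {a b a' b' : ℝ}
    (ha : N.ρ k (N.S k (e i)) = a) (hb : dualNorm (N.ρ (n - k)) (N.Stilde k (e i)) = b)
    (ha' : N'.ρ k (N'.S k x) = a') (hb' : dualNorm (N'.ρ (n - k)) (N'.Stilde k x) = b') :
    a - g ≤ a' + t ∧ b' ≤ b - g + t := by
  constructor
  · have h1 : N.S k x = ∑ i, incUp κ Γ (c i) • N.S k (e i) := by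
      rw [← redS_mkQ, hx, map_sum]
      exact Finset.sum_congr rfl fun i _ => by rw [map_smul, map_smul_eq, redS_mkQ]
    have h2 := he.up.orthogonal fun i => incUp κ Γ (c i)
    rw [← h1] at h2
    have h3 := le_iSup (fun i => N.ρ k (N.S k (e i)) - nuUp (incUp κ Γ (c i))) i
    rw [← h2] at h3
    have h4 : nuUp (incUp κ Γ (c i)) ≤ ((g : ℝ) : EReal) :=
      LamUp.nuUp_le (by rwa [LamUp.incUp_coeff])
    have h5 := m.le_add' k (N.S k x)
    rw [← m.comp, ha'] at h5
    have h6 := ((EReal.sub_le_sub le_rfl h4).trans h3).trans h5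
    rw [ha, ← EReal.coe_sub, ← EReal.coe_add, EReal.coe_le_coe_iff] at h6
    exact h6
  · have h1 : N.Stilde k x = ∑ i, incDown κ Γ (c i) • N.Stilde k (e i) := by
      rw [← redStilde_mkQ, hx, map_sum]
      exact Finset.sum_congr rfl fun i _ => by rw [map_smul, redStilde_mkQ]; rfl
    have h2 := he.down.orthogonal fun i => incDown κ Γ (c i)
    rw [← h1] at h2
    have h3 := iInf_le (fun i => dualNorm (N.ρ (n - k)) (N.Stilde k (e i)) -
      nuDown (incDown κ Γ (c i))) i
    rw [← h2] at h3
    have h4 : ((g : ℝ) : EReal) ≤ nuDown (incDown κ Γ (c i)) := by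
      have h5 : nuUp (conjDown κ Γ (incDown κ Γ (c i))) ≤ (((-g : Γ) : ℝ) : EReal) :=
        LamUp.nuUp_le (by rwa [conjDown_incDown, LamUp.incUp_coeff, conj_coeff, neg_neg])
      rw [nuUp_conjDown, EReal.neg_le, ← EReal.coe_neg, AddSubgroup.coe_neg, neg_neg] at h5
      exact h5
    have h5 := m.dualNorm_le k x
    have h6 := h5.trans (add_le_add (h3.trans (EReal.sub_le_sub le_rfl h4)) le_rfl)
    rw [hb, hb', ← EReal.coe_sub, ← EReal.coe_add, EReal.coe_le_coe_iff] at h6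
    exact h6

/-- Doubly-orthogonal bases of structures at distance at most `t` can be matched. -/
theorem TMorphism.exists_equiv {N N' : WeakPNStructure P} {t : ℝ} (m : TMorphism N N' t) {k : ℤ}
    {d d' : ℕ} {e : Fin d → H k} {e' : Fin d' → H k} {a b : Fin d → ℝ} {a' b' : Fin d' → ℝ}
    (he : IsDoublyOrthogonalBasis (N.S k) (N.ρ k) (N.Stilde k) (dualNorm (N.ρ (n - k))) e)
    (ha : ∀ i, N.ρ k (N.S k (e i)) = a i)
    (hb : ∀ i, dualNorm (N.ρ (n - k)) (N.Stilde k (e i)) = b i)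
    (he' : IsDoublyOrthogonalBasis (N'.S k) (N'.ρ k) (N'.Stilde k) (dualNorm (N'.ρ (n - k))) e')
    (ha' : ∀ i, N'.ρ k (N'.S k (e' i)) = a' i)
    (hb' : ∀ i, dualNorm (N'.ρ (n - k)) (N'.Stilde k (e' i)) = b' i) :
    ∃ τ : Fin d ≃ Fin d', ∀ i, ∃ g : Γ,
      |a' (τ i) - (a i - g)| ≤ t ∧ |b' (τ i) - (b i - g)| ≤ t := by
  let E := Module.Basis.mk he.linearIndependent he.span_eq_top.ge
  let E' := Module.Basis.mk he'.linearIndependent he'.span_eq_top.ge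
  have hE : ∀ i, E i = Submodule.mkQ _ (e i) := fun i => by simp [E]
  have hE' : ∀ i, E' i = Submodule.mkQ _ (e' i) := fun i => by simp [E']
  have hmul : ∀ i i', ∑ j, E'.repr (E i) j * E.repr (E' j) i' = if i' = i then 1 else 0 := by
    intro i i'
    have := congrFun (congrFun (E.toMatrix_mul_toMatrix_flip E') i') i
    rw [Matrix.mul_apply, Matrix.one_apply] at this
    rw [← this]
    exact Finset.sum_congr rfl fun j _ => mul_comm _ _
  -- The bounds for the two transition matrices come from the morphism and from its inverse.
  obtain ⟨f, hf, hfg⟩ := exists_matching (t := t) a b a' b' (fun j i => E.repr (E' j) i)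
    (fun i j => E'.repr (E i) j) (fun i => by rw [hmul, if_pos rfl])
    (fun i i' h => by rw [hmul, if_neg (Ne.symm h)])
    (fun j i g hg => m.coeff_bound he (x := e' j) (c := fun i => E.repr (E' j) i)
      (by rw [← hE']; simp only [← hE]; exact (E.sum_repr _).symm) hg (ha i) (hb i) (ha' j) (hb' j))
    (fun i j g hg => m.symm.coeff_bound he' (x := e i) (c := fun j => E'.repr (E i) j)
      (by rw [← hE]; simp only [← hE']; exact (E'.sum_repr _).symm) hg (ha' j) (hb' j) (ha i) (hb i))
  have hcard : Fintype.card (Fin d) = Fintype.card (Fin d') := by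
    rw [← Module.finrank_eq_card_basis E, ← Module.finrank_eq_card_basis E']
  exact ⟨Equiv.ofBijective f ((Fintype.bijective_iff_injective_and_card f).mpr ⟨hf, hcard⟩), hfg⟩

end WeakPNStructure

/-! ### Bars and multisets -/

section Multisets

open Classical in
/-- The elements of the image multiset of a finite type correspond to the elements of that type. -/
theorem exists_equiv_toType_map {ι α : Type*} [Fintype ι] (f : ι → α) (M : Multiset α)
    (hM : M = Finset.univ.val.map f) : ∃ ε : ι ≃ M.ToType, ∀ i, (ε i).1 = f i := by
  subst hM
  have hcard : ∀ y, Fintype.card {i // f i = y} = (Finset.univ.val.map f).count y := by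
    intro y
    rw [Multiset.count_map, Fintype.card_subtype, Finset.card_def, Finset.filter_val]
    congr 1
    exact Multiset.filter_congr fun i _ => eq_comm
  let ε : (Σ y, {i // f i = y}) ≃ (Σ y, Fin ((Finset.univ.val.map f).count y)) :=
    Equiv.sigmaCongrRight fun y => Fintype.equivFinOfCardEq (hcard y)
  exact ⟨(Equiv.sigmaFiberEquiv f).symm.trans ε, fun i => rfl⟩

open Classical in
-- This presents the closed and the open bars as images of finite types, the form required by
-- `exists_equiv_toType_map`.
theorem filterMap_univ_eq_map {ι α : Type*} [Fintype ι] (p : ι → Prop) (F : ∀ i, p i → α) :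
    (Finset.univ : Finset ι).val.filterMap (fun i => if h : p i then some (F i h) else none) =
      (Finset.univ : Finset {i // p i}).val.map fun i => F i.1 i.2 := by
  have h1 : (Finset.univ : Finset {i // p i}).val.map Subtype.val =
      (Finset.univ : Finset ι).val.filter p := by
    have := congrArg Finset.val (Finset.subtype_map p (s := (Finset.univ : Finset ι)))
    rw [Finset.subtype_univ] at this
    exact this
  rw [← Multiset.filter_add_not p Finset.univ.val, Multiset.filterMap_add, ← h1,
    Multiset.filterMap_map]
  have h2 : Multiset.filterMap (fun i => if h : p i then some (F i h) else none)
      ((Finset.univ : Finset ι).val.filter fun i => ¬ p i) = 0 := by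
    refine Multiset.eq_zero_of_forall_notMem fun y hy => ?_
    obtain ⟨i, hi, hiy⟩ := (Multiset.mem_filterMap _ _).mp hy
    rw [dif_neg (Multiset.mem_filter.mp hi).2] at hiy
    cases hiy
  rw [h2, add_zero, ← Multiset.filterMap_eq_map]
  congr 1
  funext i
  simp [i.2]

end Multisets

/-! ### Endpoints of bars and labelling by spectrum elements. -/

section Bars

variable {Γ : AddSubgroup ℝ}

/-- The endpoints are recovered from an interval as its infimum and supremum. -/
theorem exists_of_closedBar_eq {a b c d : ℝ} {h : a ≤ b} {h' : c ≤ d}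
    (heq : closedBar Γ a b h = closedBar Γ c d h') : ∃ g : Γ, c = a + g ∧ d = b + g := by
  obtain ⟨g, hg, hI⟩ := Quotient.exact heq
  have hI' : Set.Icc (a + g) (b + g) = Set.Icc c d := (Set.image_add_const_Icc g a b).symm.trans hI
  have hle : a + g ≤ b + g := by linarith
  refine ⟨⟨g, hg⟩, ?_, ?_⟩
  · rw [← csInf_Icc h', ← hI', csInf_Icc hle]
  · rw [← csSup_Icc h', ← hI', csSup_Icc hle]

theorem exists_of_openBar_eq {a b c d : ℝ} {h : a < b} {h' : c < d}
    (heq : openBar Γ a b h = openBar Γ c d h') : ∃ g : Γ, c = a + g ∧ d = b + g := by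
  obtain ⟨g, hg, hI⟩ := Quotient.exact heq
  have hI' : Set.Ioo (a + g) (b + g) = Set.Ioo c d := (Set.image_add_const_Ioo g a b).symm.trans hI
  have hle : a + g < b + g := by linarith
  refine ⟨⟨g, hg⟩, ?_, ?_⟩
  · rw [← csInf_Ioo h', ← hI', csInf_Ioo hle]
  · rw [← csSup_Ioo h', ← hI', csSup_Ioo hle]

/-- A closed interval contains its infimum, an open one does not. -/
theorem closedBar_ne_openBar {a b c d : ℝ} {h : a ≤ b} {h' : c < d} :
    closedBar Γ a b h ≠ openBar Γ c d h' := by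
  intro heq
  obtain ⟨g, hg, hI⟩ := Quotient.exact heq
  have hI' : Set.Icc (a + g) (b + g) = Set.Ioo c d := (Set.image_add_const_Icc g a b).symm.trans hI
  have hle : a + g ≤ b + g := by linarith
  have h1 : a + g = c := by rw [← csInf_Icc hle, hI', csInf_Ioo h']
  have h2 : a + g ∈ Set.Ioo c d := hI' ▸ Set.left_mem_Icc.mpr hle
  exact absurd h2.1 (by rw [h1]; exact lt_irrefl c)

/-- The bars of a graded barcode computed from basis spectra correspond to the elements of the
basis spectra. -/
theorem exists_equiv_allBars {d : ℤ → ℕ} (a b : ∀ k, Fin (d k) → ℝ) (B : ℤ → Multiset (Bar Γ))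
    (spec : ℤ → Multiset ((ℝ ⧸ Γ) × ℝ))
    (hspec : ∀ k, spec k = Finset.univ.val.map fun i =>
      ((QuotientAddGroup.mk (a k i) : ℝ ⧸ Γ), b k i - a k i))
    (hB : ∀ k, B k = closedBars Γ (spec k) + openBars Γ (spec (k + 1))) :
    ∃ ε : (Σ k, Fin (d k)) ≃ AllBars B, ∀ k i,
      (∃ h : a k i ≤ b k i, (ε ⟨k, i⟩).degree = k ∧
        (ε ⟨k, i⟩).bar = closedBar Γ (a k i) (b k i) h) ∨
      (∃ h : b k i < a k i, (ε ⟨k, i⟩).degree = k - 1 ∧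
        (ε ⟨k, i⟩).bar = openBar Γ (b k i) (a k i) h) := by
  classical
  have hclosed : ∀ k, closedBars Γ (spec k) =
      (Finset.univ : Finset {i // 0 ≤ b k i - a k i}).val.map fun i : {i // 0 ≤ b k i - a k i} =>
        closedBar Γ (a k i) (b k i) (sub_nonneg.mp i.2) := by
    intro k
    rw [hspec, closedBars, Multiset.filterMap_map]
    refine Eq.trans ?_ (filterMap_univ_eq_map (fun i => 0 ≤ b k i - a k i) fun i h =>
      closedBar Γ (a k i) (b k i) (sub_nonneg.mp h))
    congr 1
    funext i
    simp only [Function.comp_apply]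
    split_ifs with h
    · congr 1
      change closedBar Γ (a k i) (a k i + (b k i - a k i)) (by linarith) = _
      congr 1; ring
    · rfl
  have hopen : ∀ k, openBars Γ (spec k) =
      (Finset.univ : Finset {i // b k i - a k i < 0}).val.map fun i : {i // b k i - a k i < 0} =>
        openBar Γ (b k i) (a k i) (sub_neg.mp i.2) := by
    intro k
    rw [hspec, openBars, Multiset.filterMap_map]
    refine Eq.trans ?_ (filterMap_univ_eq_map (fun i => b k i - a k i < 0) fun i h =>
      openBar Γ (b k i) (a k i) (sub_neg.mp h))
    congr 1
    funext i
    simp only [Function.comp_apply]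
    split_ifs with h
    · congr 1
      change openBar Γ (a k i + (b k i - a k i)) (a k i) (by linarith) = _
      congr 1; ring
    · rfl
  -- Degree m receives closed bars from the spectrum in degree m and open bars from degree m + 1;
  -- `φ` below undoes this shift.
  let ι : ℤ → Type := fun m =>
    {i // 0 ≤ b m i - a m i} ⊕ {i // b (m + 1) i - a (m + 1) i < 0}
  let L : ∀ m, ι m → Bar Γ := fun m => Sum.elim
    (fun i => closedBar Γ (a m i) (b m i) (sub_nonneg.mp i.2))
    (fun i => openBar Γ (b (m + 1) i) (a (m + 1) i) (sub_neg.mp i.2))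
  have hL : ∀ m, B m = Finset.univ.val.map (L m) := by
    intro m
    rw [hB, hclosed, hopen]
    change _ = Multiset.map (L m) (Finset.univ.disjSum Finset.univ : Finset (ι m)).val
    rw [Finset.val_disjSum, Multiset.map_disjSum]
    rfl
  choose η hη using fun m => exists_equiv_toType_map (L m) (B m) (hL m)
  let φ : (Σ m, ι m) → Σ k, Fin (d k) := fun x => match x with
    | ⟨m, Sum.inl i⟩ => ⟨m, i.1⟩
    | ⟨m, Sum.inr i⟩ => ⟨m + 1, i.1⟩
  have hφ : Function.Bijective φ := by
    constructor
    · rintro ⟨m, i | i⟩ ⟨m', i' | i'⟩ h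
      · obtain ⟨h1, h2⟩ := Sigma.mk.inj_iff.mp h
        change m = m' at h1
        subst h1
        rw [Subtype.ext (eq_of_heq h2)]
      · obtain ⟨h1, h2⟩ := Sigma.mk.inj_iff.mp h
        change m = m' + 1 at h1
        subst h1
        have := eq_of_heq h2
        exact absurd i'.2 (not_lt.mpr (this ▸ i.2))
      · obtain ⟨h1, h2⟩ := Sigma.mk.inj_iff.mp h
        change m + 1 = m' at h1
        subst h1
        have := eq_of_heq h2
        exact absurd i.2 (not_lt.mpr (this ▸ i'.2))
      · obtain ⟨h1, h2⟩ := Sigma.mk.inj_iff.mp h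
        obtain rfl : m = m' := by simpa using h1
        rw [Subtype.ext (eq_of_heq h2)]
    · rintro ⟨k, i⟩
      by_cases h : 0 ≤ b k i - a k i
      · exact ⟨⟨k, Sum.inl ⟨i, h⟩⟩, rfl⟩
      · obtain ⟨m, rfl⟩ : ∃ m, k = m + 1 := ⟨k - 1, by ring⟩
        exact ⟨⟨m, Sum.inr ⟨i, not_le.mp h⟩⟩, rfl⟩
  let Φ := Equiv.ofBijective φ hφ
  let ψ : (Σ m, ι m) ≃ AllBars B := Equiv.sigmaCongrRight η
  have hψ : ∀ m i, (ψ ⟨m, i⟩).degree = m ∧ (ψ ⟨m, i⟩).bar = L m i := fun m i => ⟨rfl, hη m i⟩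
  refine ⟨Φ.symm.trans ψ, fun k i => ?_⟩
  rw [Equiv.trans_apply]
  by_cases h : 0 ≤ b k i - a k i
  · have hΦ : Φ.symm ⟨k, i⟩ = ⟨k, Sum.inl ⟨i, h⟩⟩ := by
      rw [Equiv.symm_apply_eq]; rfl
    rw [hΦ]
    exact Or.inl ⟨sub_nonneg.mp h, hψ _ _⟩
  · obtain ⟨m, rfl⟩ : ∃ m, k = m + 1 := ⟨k - 1, by ring⟩
    have hΦ : Φ.symm ⟨m + 1, i⟩ = ⟨m, Sum.inr ⟨i, not_le.mp h⟩⟩ := by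
      rw [Equiv.symm_apply_eq]; rfl
    rw [hΦ]
    refine Or.inr ⟨sub_neg.mp (not_le.mp h), ?_, (hψ _ _).2⟩
    rw [(hψ _ _).1]; ring

end Bars

/-! ### Matching of essential barcodes. -/

namespace WeakPNStructure

variable {κ : Type*} [Field κ] {Γ : AddSubgroup ℝ} [DiscreteTopology Γ] {n : ℤ} {H : ℤ → Type*}
  [∀ k, AddCommGroup (H k)] [∀ k, Module (Lam κ Γ) (H k)] {P : WeakPDStructure κ Γ n H}

/-- Essential barcodes of structures at distance at most `t` can be matched. -/
theorem TMorphism.exists_bar_equiv {N N' : WeakPNStructure P} {t : ℝ} (m : TMorphism N N' t)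
    {B B' : ℤ → Multiset (Bar Γ)} (hB : N.IsEssentialBarcode B) (hB' : N'.IsEssentialBarcode B') :
    ∃ σ : AllBars B ≃ AllBars B',
      (∀ (x : AllBars B) (a b : ℝ) (hab : a ≤ b), x.bar = closedBar Γ a b hab →
        ∃ a' b' : ℝ, |a' - a| ≤ t ∧ |b' - b| ≤ t ∧
          ((∃ h : a' ≤ b', (σ x).degree = x.degree ∧ (σ x).bar = closedBar Γ a' b' h) ∨
            (∃ h : b' < a', (σ x).degree = x.degree - 1 ∧
              (σ x).bar = openBar Γ b' a' h))) ∧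
      (∀ (x : AllBars B) (a b : ℝ) (hab : a < b), x.bar = openBar Γ a b hab →
        ∃ a' b' : ℝ, |a' - a| ≤ t ∧ |b' - b| ≤ t ∧
          ((∃ h : a' < b', (σ x).degree = x.degree ∧ (σ x).bar = openBar Γ a' b' h) ∨
            (∃ h : b' ≤ a', (σ x).degree = x.degree + 1 ∧
              (σ x).bar = closedBar Γ b' a' h))) := by
  obtain ⟨spec, hspec, hBk⟩ := hB
  obtain ⟨spec', hspec', hBk'⟩ := hB'
  choose d e a b he ha hb hs using hspec
  choose d' e' a' b' he' ha' hb' hs' using hspec'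
  choose τ hτ using fun k =>
    m.exists_equiv (he k) (ha k) (hb k) (he' k) (ha' k) (hb' k)
  obtain ⟨ε, hε⟩ := exists_equiv_allBars a b B spec hs hBk
  obtain ⟨ε', hε'⟩ := exists_equiv_allBars a' b' B' spec' hs' hBk'
  -- The given endpoints of a bar may be any Γ-translate of the values of the basis; the matched bar
  -- is translated along.
  have hmatch : ∀ k i (g : Γ), ∃ g' : Γ,
      |a' k (τ k i) + g' - (a k i + g)| ≤ t ∧ |b' k (τ k i) + g' - (b k i + g)| ≤ t := by
    intro k i g
    obtain ⟨g1, h1, h2⟩ := hτ k i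
    refine ⟨g1 + g, ?_, ?_⟩
    · convert h1 using 2; push_cast; ring
    · convert h2 using 2; push_cast; ring
  refine ⟨ε.symm.trans ((Equiv.sigmaCongrRight τ).trans ε'), ?_, ?_⟩
  · intro x α β hαβ hx
    obtain ⟨⟨k, i⟩, rfl⟩ := ε.surjective x
    have hσ : (ε.symm.trans ((Equiv.sigmaCongrRight τ).trans ε')) (ε ⟨k, i⟩) =
        ε' ⟨k, τ k i⟩ := by simp
    rw [hσ]
    rcases hε k i with ⟨h, hdeg, hbar⟩ | ⟨h, hdeg, hbar⟩
    · obtain ⟨g, rfl, rfl⟩ := exists_of_closedBar_eq (hbar.symm.trans hx)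
      obtain ⟨g', h1, h2⟩ := hmatch k i g
      refine ⟨a' k (τ k i) + g', b' k (τ k i) + g', h1, h2, ?_⟩
      rcases hε' k (τ k i) with ⟨h', hdeg', hbar'⟩ | ⟨h', hdeg', hbar'⟩
      · refine Or.inl ⟨by linarith, hdeg'.trans hdeg.symm, hbar'.trans ?_⟩
        exact closedBar_add Γ _ _ g' g'.2 _ _
      · refine Or.inr ⟨by linarith, by rw [hdeg, hdeg'], hbar'.trans ?_⟩
        exact openBar_add Γ _ _ g' g'.2 _ _
    · exact absurd (hx.symm.trans hbar) closedBar_ne_openBar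
  · intro x α β hαβ hx
    obtain ⟨⟨k, i⟩, rfl⟩ := ε.surjective x
    have hσ : (ε.symm.trans ((Equiv.sigmaCongrRight τ).trans ε')) (ε ⟨k, i⟩) =
        ε' ⟨k, τ k i⟩ := by simp
    rw [hσ]
    rcases hε k i with ⟨h, hdeg, hbar⟩ | ⟨h, hdeg, hbar⟩
    · exact absurd (hbar.symm.trans hx) closedBar_ne_openBar
    · obtain ⟨g, rfl, rfl⟩ := exists_of_openBar_eq (hbar.symm.trans hx)
      obtain ⟨g', h1, h2⟩ := hmatch k i g
      -- The lower endpoint of an open bar is the value `b`, so the two estimates are exchanged.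
      refine ⟨b' k (τ k i) + g', a' k (τ k i) + g', h2, h1, ?_⟩
      rcases hε' k (τ k i) with ⟨h', hdeg', hbar'⟩ | ⟨h', hdeg', hbar'⟩
      · refine Or.inr ⟨by linarith, by rw [hdeg, hdeg']; ring, hbar'.trans ?_⟩
        exact closedBar_add Γ _ _ g' g'.2 _ _
      · refine Or.inl ⟨by linarith, by rw [hdeg, hdeg'], hbar'.trans ?_⟩
        exact openBar_add Γ _ _ g' g'.2 _ _

end WeakPNStructure

end PoincareNovikov

end

/-! ### The stability theorem. -/

theorem mainTheorem12 {κ : Type*} [Field κ] (Γ : AddSubgroup ℝ) [DiscreteTopology Γ] {n : ℤ}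
    {H : ℤ → Type*} [∀ k, AddCommGroup (H k)] [∀ k, Module (PoincareNovikov.Lam κ Γ) (H k)]
    (P : PoincareNovikov.WeakPDStructure κ Γ n H)
    (N : PoincareNovikov.WeakPNStructure P) (N' : PoincareNovikov.WeakPNStructure P)
    (t : ℝ) (ht : 0 ≤ t)
    (hmor : Nonempty (PoincareNovikov.WeakPNStructure.TMorphism N N' t)) :
    (∃ B, N.IsEssentialBarcode B) ∧ (∃ B', N'.IsEssentialBarcode B') ∧
    ∀ B B' : ℤ → Multiset (PoincareNovikov.Bar Γ),
      N.IsEssentialBarcode B → N'.IsEssentialBarcode B' →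
      ∃ σ : PoincareNovikov.AllBars B ≃ PoincareNovikov.AllBars B',
        (∀ (x : PoincareNovikov.AllBars B) (a b : ℝ) (hab : a ≤ b),
          x.bar = PoincareNovikov.closedBar Γ a b hab →
          ∃ a' b' : ℝ, |a' - a| ≤ t ∧ |b' - b| ≤ t ∧
            ((∃ h : a' ≤ b', (σ x).degree = x.degree ∧
                (σ x).bar = PoincareNovikov.closedBar Γ a' b' h) ∨
              (∃ h : b' < a', (σ x).degree = x.degree - 1 ∧
                (σ x).bar = PoincareNovikov.openBar Γ b' a' h))) ∧
        (∀ (x : PoincareNovikov.AllBars B) (a b : ℝ) (hab : a < b),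
          x.bar = PoincareNovikov.openBar Γ a b hab →
          ∃ a' b' : ℝ, |a' - a| ≤ t ∧ |b' - b| ≤ t ∧
            ((∃ h : a' < b', (σ x).degree = x.degree ∧
                (σ x).bar = PoincareNovikov.openBar Γ a' b' h) ∨
              (∃ h : b' ≤ a', (σ x).degree = x.degree + 1 ∧
                (σ x).bar = PoincareNovikov.closedBar Γ b' a' h))) := by
  obtain ⟨m⟩ := hmor
  exact ⟨N.exists_isEssentialBarcode, N'.exists_isEssentialBarcode, fun _ _ hB hB' =>
    m.exists_bar_equiv hB hB'⟩
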